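/- Let $\epsilon>0$, $\lambda>0$, and let $u_0(x)=\sum_{p=1}^P\left(\frac{c_p}{x-z_p}+\frac{c_p^*}{x-z_p^*}\right)$ with $c_p\in\mathbb C\setminus\{0\}$, $\mathrm{Im}\,z_p>0$, $\mathrm{Re}\,z_1<\dots<\mathrm{Re}\,z_P$ and $\sum_{p}(c_p+c_p^*)=0$. Put $$f(x)=\sum_{p=1}^P\left[c_p\left(\mathrm{Log}(i(x-z_p))+\tfrac{\pi i}{2}\right)+c_p^*\left(\mathrm{Log}(-i(x-z_p^*))-\tfrac{\pi i}{2}\right)\right],\qquad h(x)=\lambda x+f(x),$$ with principal logarithms, so that $f'=u_0$ and $f$ is analytic on the plane $G$ cut vertically upwards from each $z_p$ and vertically downwards from each $z_p^*$; let $G_0$ be the half-plane $\mathrm{Re}\,x<\mathrm{Re}\,z_1$ (all of $\mathbb C$ if $P=0$). Let $\ell_0(x)$ denote any contour that comes from $-i\infty$ in $G_0$ (with $\mathrm{Im}\,z$ tending to $-\infty$ at least linearly in the parameter of a Lipschitz parametrisation), runs in $G$, and ends at $x$, where $x\in G$ or $x=z_m$. Let $U_m^>$ denote any contour on the Riemann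 surface of $f$ that comes from $-i\infty$ in $G_0$, where $f(\infty)=0$, encircles $z_1,\dots,z_m$ once each in the positive sense by crossing, in this order, each once and from right to left, the upward cuts of $z_m,\dots,z_1$ (and meeting no cut otherwise), and returns to $-i\infty$ in $G_0$ in the same manner, $f$ being continued along it. Let $C_m^>=\ell_0(z_m)$ if $ic_m/\epsilon$ is a strictly negative integer and $C_m^>=U_m^>$ otherwise. For $v=(v_1,\dots,v_P)\in\mathbb C^P$ define $$W_+(x)=-\frac{i}{\epsilon}e^{ih(x)/\epsilon}\int_{\ell_0(x)}e^{-ih(z)/\epsilon}\left(\lambda+\sum_{p=1}^P\frac{v_p}{z-z_p}\right)dz,\qquad x\in G.$$ Then the integral defining $W_+(x)$ and, for $1\le m,p\le P$, the integrals over $C_m^>$ below converge absolutely, and the following are equivalent: 1. $W_+$ is analytic in the upper half-plane, that is, there is an analytic function on $\{\mathrm{Im}\,x>0\}$ that equals $W_+$ on $G\cap\{\mathrm{Im}\,x>0\}$; 2. $\displaystyle\int_{C_m^>}e^{-ih(z)/\epsilon}\left(\sum_{p=1}^P\frac{v_p}{z-z_p}+\lambda\right)dz=0$ for $m=1,\dots,P$;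 3. $\mathbf A^>v=\mathbf b^>$, where $\displaystyle A^>_{mp}=\int_{C_m^>}\frac{e^{-ih(z)/\epsilon}}{z-z_p}\,dz$ and $\displaystyle b^>_m=-\lambda\int_{C_m^>}e^{-ih(z)/\epsilon}\,dz$. Moreover, when these conditions hold, the analytic continuation of $W_+$ satisfies $c_pW_+(z_p)=v_p$ for $p=1,\dots,P$. -/

import Mathlib

namespace BenjaminOno

open Complex Set Filter Topology

/-- A real bounded rational potential with simple poles, decaying and integrable on the real line:
`u₀(x) = ∑ c_p / (x - z_p) + c.c.`; the index `p : Fin P` stands for `p = 1, …, P`. -/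
structure RationalPotential (P : ℕ) where
  z : Fin P → ℂ
  c : Fin P → ℂ
  c_ne_zero : ∀ p, c p ≠ 0
  im_z_pos : ∀ p, 0 < (z p).im
  re_z_strictMono : StrictMono fun p => (z p).re
  sum_c : ∑ p, (c p + (starRingEnd ℂ) (c p)) = 0

namespace RationalPotential

variable {P : ℕ} (u : RationalPotential P)

/-- The rational function `u₀` of a complex variable. -/
noncomputable def u₀ (x : ℂ) : ℂ :=
  ∑ p, (u.c p / (x - u.z p) + (starRingEnd ℂ) (u.c p) / (x - (starRingEnd ℂ) (u.z p)))

/-- The antiderivative `f` of `u₀`, with principal logarithms: the cut of the term of `z_p` runs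
from `z_p` vertically upwards, that of the conjugate term from `z_p^*` vertically downwards. -/
noncomputable def f (x : ℂ) : ℂ :=
  ∑ p, (u.c p * (Complex.log (I * (x - u.z p)) + Real.pi * I / 2) +
    (starRingEnd ℂ) (u.c p) *
      (Complex.log (-I * (x - (starRingEnd ℂ) (u.z p))) - Real.pi * I / 2))

/-- The domain of analyticity of `f`: the plane without the closed branch cuts. -/
def G : Set ℂ :=
  {x | ∀ p, I * (x - u.z p) ∈ Complex.slitPlane ∧
    -I * (x - (starRingEnd ℂ) (u.z p)) ∈ Complex.slitPlane}

/-- The half-plane `Re x < Re z_1`. -/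
def G₀ : Set ℂ := {x | ∀ p, x.re < (u.z p).re}

/-- The open branch cut from `z_p` vertically upwards. -/
def upperCut (p : Fin P) : Set ℂ := {x | x.re = (u.z p).re ∧ (u.z p).im < x.im}

end RationalPotential

/-- A parametrised contour together with the value of (a branch of) `f` carried along it, that is,
a contour on the Riemann surface of `f`. -/
structure LiftedContour where
  path : ℝ → ℂ
  fval : ℝ → ℂ

/-- Regularity of a parametrisation (satisfied by piecewise `C¹` curves with bounded speed). -/
def IsRegularPath (γ : ℝ → ℂ) : Prop :=
  (∃ K, LipschitzWith K γ) ∧ ∃ S : Set ℝ, S.Finite ∧ ∀ t ∉ S, DifferentiableAt ℝ γ t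

/-- The path comes from `-i∞` in `G₀` as `t → -∞`. -/
def StartsAtNegI {P : ℕ} (u : RationalPotential P) (γ : ℝ → ℂ) : Prop :=
  ∃ δ > 0, ∃ T : ℝ, ∀ t ≤ T, γ t ∈ u.G₀ ∧ (γ t).im ≤ δ * t

/-- The path goes to `-i∞` in `G₀` as `t → +∞`. -/
def EndsAtNegI {P : ℕ} (u : RationalPotential P) (γ : ℝ → ℂ) : Prop :=
  ∃ δ > 0, ∃ T : ℝ, ∀ t ≥ T, γ t ∈ u.G₀ ∧ (γ t).im ≤ -(δ * t)

/-- `C` is a contour `ℓ₀(x)`: it comes from `-i∞` in `G₀`, runs in `G` and arrives at `x` at time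
`0` (where it then rests, so that times `t > 0` contribute nothing to integrals along `C`).
It carries the values of `f` itself. The end point is a point of `G` or one of the `z_m`. -/
structure IsEllZero {P : ℕ} (u : RationalPotential P) (x : ℂ) (C : LiftedContour) : Prop where
  regular : IsRegularPath C.path
  start : StartsAtNegI u C.path
  mem_G : ∀ t < 0, C.path t ∈ u.G
  arrives : ∀ t ≥ 0, C.path t = x
  fval_eq : ∀ t, C.fval t = u.f (C.path t)

/-- `C` is a contour `U_m^>` on the Riemann surface of `f`: it comes from `-i∞` in `G₀` with the
value `f(∞) = 0`, goes around `z_1, …, z_m` once in the positive sense and returns to `-i∞` in `G₀`.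
It meets the branch cuts of `f` only in the upper cuts of `z_m, …, z_1`, each
crossed once, from right to left (which is counterclockwise about `z_p`), in this order, and
`f` is continued along it as an antiderivative of `u₀`. -/
structure IsLoop {P : ℕ} (u : RationalPotential P) (m : Fin P) (C : LiftedContour) : Prop where
  regular : IsRegularPath C.path
  start : StartsAtNegI u C.path
  finish : EndsAtNegI u C.path
  crossings : ∃ τ : Fin P → ℝ, StrictAntiOn τ (Iic m) ∧
    (∀ p ≤ m, C.path (τ p) ∈ u.upperCut p ∧
      (∀ᶠ t in 𝓝[<] (τ p), (u.z p).re < (C.path t).re) ∧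
      (∀ᶠ t in 𝓝[>] (τ p), (C.path t).re < (u.z p).re)) ∧
    ∀ t, (∀ p ≤ m, t ≠ τ p) → C.path t ∈ u.G
  fval_continuous : Continuous C.fval
  fval_deriv : ∃ S : Set ℝ, S.Finite ∧
    ∀ t ∉ S, HasDerivAt C.fval (u.u₀ (C.path t) * deriv C.path t) t
  fval_start : Tendsto C.fval atBot (𝓝 0)

/-- `C` is a contour `C_m^>`: `ℓ₀(z_m)` if `i c_m / ε` is a strictly negative integer, and `U_m^>`
otherwise. -/
def IsContourC {P : ℕ} (u : RationalPotential P) (ε : ℝ) (m : Fin P) (C : LiftedContour) : Prop :=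
  ((∃ n : ℕ, I * u.c m / ε = -((n : ℂ) + 1)) → IsEllZero u (u.z m) C) ∧
  ((¬ ∃ n : ℕ, I * u.c m / ε = -((n : ℂ) + 1)) → IsLoop u m C)

/-- The pull-back to the parameter line of `e^{-ih(z)/ε} g(z) dz`, where `h = lam z + f` and the
branch of `f` is the one carried by the contour. -/
noncomputable def pullback (ε lam : ℝ) (C : LiftedContour) (g : ℂ → ℂ) (t : ℝ) : ℂ :=
  Complex.exp (-I * (lam * C.path t + C.fval t) / ε) * g (C.path t) * deriv C.path t

/-- The contour integral `∫_C e^{-ih(z)/ε} g(z) dz`. -/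
noncomputable def contourIntegral (ε lam : ℝ) (C : LiftedContour) (g : ℂ → ℂ) : ℂ :=
  ∫ t : ℝ, pullback ε lam C g t

/-- The rational factor `∑ v_p / (z - z_p) + lam`. -/
noncomputable def ratFactor {P : ℕ} (u : RationalPotential P) (lam : ℝ) (v : Fin P → ℂ) (x : ℂ) :
    ℂ :=
  ∑ p, v p / (x - u.z p) + lam

/-- The function `W_+` on `G`, computed with the contours `ell x` from `∞` in `G₀` to `x`. -/
noncomputable def Wplus {P : ℕ} (u : RationalPotential P) (ε lam : ℝ) (v : Fin P → ℂ)
    (ell : ℂ → LiftedContour) (x : ℂ) : ℂ :=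
  -(I / ε) * Complex.exp (I * (lam * x + u.f x) / ε) *
    contourIntegral ε lam (ell x) (ratFactor u lam v)

/-- `F` is analytic in the open upper half-plane and extends `W` (given on `G`) there. -/
def IsAnalyticExtension {P : ℕ} (u : RationalPotential P) (W F : ℂ → ℂ) : Prop :=
  AnalyticOnNhd ℂ F {x | 0 < x.im} ∧ ∀ x ∈ u.G, 0 < x.im → F x = W x

/-- The matrix `A^>` computed on contours `C_m`. -/
noncomputable def matrixA {P : ℕ} (u : RationalPotential P) (ε lam : ℝ)
    (C : Fin P → LiftedContour) : Matrix (Fin P) (Fin P) ℂ :=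
  Matrix.of fun m p => contourIntegral ε lam (C m) fun x => 1 / (x - u.z p)

/-- The vector `b^>` computed on contours `C_m`. -/
noncomputable def vectorB {P : ℕ} (ε lam : ℝ) (C : Fin P → LiftedContour) : Fin P → ℂ :=
  fun m => -lam * contourIntegral ε lam (C m) fun _ => 1

end BenjaminOno

namespace BenjaminOno

open Complex Set Filter Topology

/-! Write `r` for the rational factor and `w = e^{-ih/ε}` for the weight. On `G` the function `w r`
has a primitive `Φ` that tends to `0` at `-i∞` along every admissible contour
(`exists_normalized_primitive`), and `W_+ = -(i/ε) e^{ih/ε} Φ`. Continued across the upper cut of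
`z_p` from right to left, `f` gains `2πi c_p`, so `w` is multiplied by a nonzero factor `q_p` and
`Φ` turns into `q_p Φ + κ_p` (`HasJumps`). In `e^{ih/ε} Φ` the factor `q_p` cancels; hence `W_+`
continues across the cut exactly when `κ_p = 0`.

The integral over `U_m^>` is a combination of `κ_1, …, κ_m` with nonzero coefficients
(`IsLoop.contourIntegral_eq`). These relations are triangular, so their vanishing is the vanishing
of the jumps.

Without jumps, `W_+` is single-valued around `z_p` and solves `W' = (i/ε)((λ + u₀) W - r)`, which
has a regular singular point there with exponent `i c_p/ε`. Such a solution grows at most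
polynomially, so it has at worst a pole, and a pole of order `n` forces the exponent to be `-n`
(`exists_analyticAt_of_regular_singular`). Outside the exceptional case the singularity is therefore
removable.

If `i c_p/ε = -(n+1)`, then `w` has a zero of order `n+1` at `z_p` and `κ_p = 0` automatically, so
the loop carries no new information. Here `Φ` is analytic at `z_p`, its derivative vanishes to order
`n`, and `W_+ = -(i/ε) Φ/w` is analytic there exactly when `Φ(z_p) = 0`. This value is the integral
over `ℓ₀(z_p)`, which explains the choice of `C_p^>` (`HasJumps.exists_analytic_primitive`).

Both sides of the equivalence thus reduce to one condition on `Φ` (`exists_extension_wave_iff`,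
`forall_contourIntegral_eq_zero_iff`). The linear system is the same condition by linearity of the
integral, and `v_p = c_p W_+(z_p)` is the differential equation multiplied by `x - z_p` in the limit
`x → z_p` (`residue_eq_of_extension`). -/

/-! ### Primitives of holomorphic functions -/

/-- Two primitives of the same function on a convex open set differ by a constant. -/
theorem sub_eq_sub_of_hasDerivAt {S : Set ℂ} (hS : Convex ℝ S) (hSo : IsOpen S) {F H g : ℂ → ℂ}
    (hF : ∀ x ∈ S, HasDerivAt F (g x) x) (hH : ∀ x ∈ S, HasDerivAt H (g x) x) {x y : ℂ}
    (hx : x ∈ S) (hy : y ∈ S) : F x - H x = F y - H y := by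
  refine hSo.is_const_of_deriv_eq_zero (f := fun x => F x - H x) hS.isPreconnected
    (fun z hz => ((hF z hz).sub (hH z hz)).differentiableAt.differentiableWithinAt) (fun z hz => ?_)
    hx hy
  have := ((hF z hz).sub (hH z hz)).deriv
  rwa [sub_self] at this

theorem exists_primitive_of_convex {S : Set ℂ} (hS : Convex ℝ S) (hSo : IsOpen S) {g : ℂ → ℂ}
    (hg : DifferentiableOn ℂ g S) : ∃ F : ℂ → ℂ, ∀ x ∈ S, HasDerivAt F (g x) x := by
  obtain ⟨F, hF⟩ := hS.exists_forall_hasDerivWithinAt hg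
  exact ⟨F, fun x hx => (hF x hx).hasDerivAt (hSo.mem_nhds hx)⟩

/-- A holomorphic function on a set that is covered by convex open pieces, each stable under the
projection to the real axis, has a primitive. -/
theorem exists_primitive_of_boxes {U H : Set ℂ} (B : ℂ → Set ℂ) (hH : Convex ℝ H) (hHo : IsOpen H)
    (hHU : H ⊆ U) (hR : ∀ r : ℝ, (r : ℂ) ∈ H)
    (hB : ∀ x ∈ U, Convex ℝ (B x) ∧ IsOpen (B x) ∧ x ∈ B x ∧ B x ⊆ U ∧
      ∀ y ∈ B x, ((y.re : ℝ) : ℂ) ∈ B x) {g : ℂ → ℂ} (hg : DifferentiableOn ℂ g U) :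
    ∃ F : ℂ → ℂ, ∀ x ∈ U, HasDerivAt F (g x) x := by
  obtain ⟨F₀, hF₀⟩ := exists_primitive_of_convex hH hHo (hg.mono hHU)
  have key : ∀ x, ∃ F : ℂ → ℂ, x ∈ U → (∀ y ∈ B x, HasDerivAt F (g y) y) ∧
      ∀ y ∈ B x, F y.re = F₀ y.re := by
    intro x
    by_cases hx : x ∈ U
    · obtain ⟨h1, h2, h3, h4, h5⟩ := hB x hx
      obtain ⟨F, hF⟩ := exists_primitive_of_convex h1 h2 (hg.mono h4)
      -- The additive constant is fixed by comparison with `F₀` at one real point; as `B x ∩ H` is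
      -- convex, the agreement extends to all real points `y.re` of the box.
      refine ⟨fun y => F y - (F x.re - F₀ x.re), fun _ => ⟨fun y hy => (hF y hy).sub_const _,
        fun y hy => ?_⟩⟩
      have := sub_eq_sub_of_hasDerivAt (h1.inter hH) (h2.inter hHo) (fun z hz => hF z hz.1)
        (fun z hz => hF₀ z hz.2) ⟨h5 y hy, hR _⟩ ⟨h5 x h3, hR _⟩
      linear_combination this
    · exact ⟨0, fun h => absurd h hx⟩
  choose F hF using key
  -- The primitives of the boxes of `x` and of `y` agree at `y.re`, which lies in both boxes, and
  -- hence at `y`.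
  refine ⟨fun x => F x x, fun x hx => ?_⟩
  obtain ⟨h1, h2, h3, h4, h5⟩ := hB x hx
  refine ((hF x hx).1 x h3).congr_of_eventuallyEq ?_
  filter_upwards [h2.mem_nhds h3] with y hy
  obtain ⟨k1, k2, k3, k4, k5⟩ := hB y (h4 hy)
  have := sub_eq_sub_of_hasDerivAt (h1.inter k1) (h2.inter k2)
    (fun z hz => (hF y (h4 hy)).1 z hz.2) (fun z hz => (hF x hx).1 z hz.1) ⟨hy, k3⟩ ⟨h5 y hy, k5 y k3⟩
  rw [(hF y (h4 hy)).2 y k3, (hF x hx).2 y hy, sub_self] at this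
  exact sub_eq_zero.1 this

/-! ### Linear differential equations with a regular singular point -/

/-- The indicial relation at a regular singular point. -/
theorem indicial_eq_zero {w A B : ℂ → ℂ} {c : ℂ} (hw : AnalyticAt ℂ w c) (hA : ContinuousAt A c)
    (hB : ContinuousAt B c) {l : Filter ℂ} [l.NeBot] (hl : l ≤ 𝓝 c)
    (h : ∀ᶠ z in l, (z - c) * deriv w z = A z * w z + B z) : A c * w c + B c = 0 := by
  have h1 : Tendsto (fun z => (z - c) * deriv w z) l (𝓝 ((c - c) * deriv w c)) :=
    (((continuousAt_id.sub continuousAt_const).mul hw.deriv.continuousAt).tendsto).mono_left hl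
  have h2 : Tendsto (fun z => A z * w z + B z) l (𝓝 (A c * w c + B c)) :=
    ((hA.mul hw.continuousAt).add hB).tendsto.mono_left hl
  have := tendsto_nhds_unique (h1.congr' h) h2
  simpa using this.symm

/-- Solutions grow at most polynomially at a regular singular point. -/
theorem norm_le_of_regular_singular {w A B : ℂ → ℂ} {c : ℂ} {R K M : ℝ} (hR : 0 < R) (hK : 1 ≤ K)
    (hM : 0 ≤ M)
    (hA : ∀ z ∈ Metric.closedBall c R, ‖A z‖ ≤ K) (hB : ∀ z ∈ Metric.closedBall c R, ‖B z‖ ≤ M)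
    (hw : ∀ z ∈ Metric.closedBall c R, z ≠ c → HasDerivAt w ((A z * w z + B z) / (z - c)) z) :
    ∃ D, ∀ z ∈ Metric.closedBall c R, z ≠ c → ‖w z‖ ≤ D * (R / ‖z - c‖) ^ K := by
  have hcomp : IsCompact (Metric.sphere c R) := isCompact_sphere c R
  have hcont : ContinuousOn w (Metric.sphere c R) := by
    intro z hz
    refine (hw z (Metric.sphere_subset_closedBall hz) ?_).continuousAt.continuousWithinAt
    rintro rfl
    simp at hz
    exact hR.ne hz
  obtain ⟨δ, hδ⟩ := hcomp.exists_bound_of_continuousOn hcont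
  refine ⟨δ + M, fun z hz hzc => ?_⟩
  have hn : 0 < ‖z - c‖ := norm_pos_iff.2 (sub_ne_zero.2 hzc)
  have hnR : ‖z - c‖ ≤ R := by simpa [dist_eq_norm] using hz
  set e : ℂ := (z - c) / ‖z - c‖ with he
  have hen : ‖e‖ = 1 := by
    rw [he, norm_div, Complex.norm_real, norm_norm, div_self hn.ne']
  set T := Real.log (R / ‖z - c‖) with hT
  have hT0 : 0 ≤ T := Real.log_nonneg ((one_le_div hn).2 hnR)
  -- On this radial path `(z - c) d/dz` becomes `-d/dt`. The singularity moves to `t = ∞`, and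
  -- Grönwall's inequality over the time `T = log (R / ‖z - c‖)` gives the power `K` of `R / ‖z -
  -- c‖`.
  set γ : ℝ → ℂ := fun t => c + R * Real.exp (-t) * e with hγ
  have hγn : ∀ t, ‖γ t - c‖ = R * Real.exp (-t) := by
    intro t
    simp only [hγ, add_sub_cancel_left, norm_mul, hen, Complex.norm_real, mul_one,
      Real.norm_eq_abs, abs_of_pos hR, abs_of_pos (Real.exp_pos _)]
  have hγmem : ∀ t, 0 ≤ t → γ t ∈ Metric.closedBall c R := by
    intro t ht
    rw [Metric.mem_closedBall, dist_eq_norm, hγn]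
    have : Real.exp (-t) ≤ 1 := Real.exp_le_one_iff.2 (by linarith)
    nlinarith
  have hγc : ∀ t, γ t ≠ c := by
    intro t h
    have := hγn t
    rw [h, sub_self, norm_zero] at this
    exact (mul_pos hR (Real.exp_pos _)).ne this
  have hγd : ∀ t, HasDerivAt γ (-(γ t - c)) t := by
    intro t
    have h1 : HasDerivAt (fun t : ℝ => Real.exp (-t)) (Real.exp (-t) * (-1)) t :=
      (Real.hasDerivAt_exp (-t)).comp t (hasDerivAt_neg t)
    have h2 := (((h1.ofReal_comp).const_mul (R : ℂ)).mul_const e).const_add c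
    refine h2.congr_deriv ?_
    simp only [hγ]
    push_cast
    ring
  have hd : ∀ t, 0 ≤ t → HasDerivAt (fun t => w (γ t)) (-(A (γ t) * w (γ t) + B (γ t))) t := by
    intro t ht
    have := (hw (γ t) (hγmem t ht) (hγc t)).comp t (hγd t)
    refine this.congr_deriv ?_
    have := sub_ne_zero.2 (hγc t)
    field_simp
  have hg := norm_le_gronwallBound_of_norm_deriv_right_le (f := fun t => w (γ t))
    (f' := fun t => -(A (γ t) * w (γ t) + B (γ t))) (δ := δ) (K := K) (ε := M) (a := 0) (b := T)
    (fun t ht => (hd t ht.1).continuousAt.continuousWithinAt)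
    (fun t ht => (hd t ht.1).hasDerivWithinAt)
    (hδ _ (by rw [mem_sphere_iff_norm, hγn]; simp))
    (fun t ht => by
      rw [norm_neg]
      refine (norm_add_le _ _).trans (add_le_add ?_ (hB _ (hγmem t ht.1)))
      rw [norm_mul]
      exact mul_le_mul_of_nonneg_right (hA _ (hγmem t ht.1)) (norm_nonneg _)) T ⟨hT0, le_rfl⟩
  have hγT : γ T = z := by
    have h1 : Real.exp (-T) = ‖z - c‖ / R := by
      rw [hT, Real.exp_neg, Real.exp_log (by positivity), inv_div]
    have h2 : (‖z - c‖ : ℂ) ≠ 0 := by exact_mod_cast hn.ne'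
    have h3 : (R : ℂ) ≠ 0 := by exact_mod_cast hR.ne'
    simp only [hγ, h1, he]
    push_cast
    field_simp
    ring
  rw [hγT] at hg
  refine hg.trans ?_
  have hK0 : K ≠ 0 := by linarith
  rw [gronwallBound_of_K_ne_0 hK0, sub_zero]
  have hE : Real.exp (K * T) = (R / ‖z - c‖) ^ K := by
    rw [Real.rpow_def_of_pos (by positivity), mul_comm]
  rw [← hE]
  have h1 : 1 ≤ Real.exp (K * T) := Real.one_le_exp (by positivity)
  have h2 : M / K ≤ M := div_le_self hM hK
  have h3 : M / K * (Real.exp (K * T) - 1) ≤ M * Real.exp (K * T) :=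
    mul_le_mul h2 (by linarith) (by linarith) hM
  linarith

/-- A single-valued solution near a regular singular point whose exponents are not negative
integers extends analytically. -/
theorem exists_analyticAt_of_regular_singular {w A B : ℂ → ℂ} {c : ℂ} (hA : ContinuousAt A c)
    (hB : ContinuousAt B c)
    (hw : ∀ᶠ z in 𝓝[≠] c, HasDerivAt w ((A z * w z + B z) / (z - c)) z)
    (hAc : ∀ n : ℕ, A c ≠ -((n : ℂ) + 1)) :
    ∃ ω : ℂ → ℂ, AnalyticAt ℂ ω c ∧ ∀ᶠ z in 𝓝[≠] c, w z = ω z := by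
  have hA1 : ∀ᶠ z in 𝓝 c, ‖A z‖ < ‖A c‖ + 1 :=
    hA.norm.eventually_lt continuousAt_const (lt_add_one _)
  have hB1 : ∀ᶠ z in 𝓝 c, ‖B z‖ < ‖B c‖ + 1 :=
    hB.norm.eventually_lt continuousAt_const (lt_add_one _)
  obtain ⟨R, hR, hball⟩ := Metric.nhds_basis_closedBall.eventually_iff.1
    ((hA1.and hB1).and (eventually_nhdsWithin_iff.1 hw))
  -- An integer growth exponent, so that `(z - c) ^ N * w` is bounded.
  obtain ⟨N, hN⟩ := exists_nat_ge (‖A c‖ + 1)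
  have hN1 : (1 : ℝ) ≤ N := le_trans (by linarith [norm_nonneg (A c)]) hN
  obtain ⟨D, hD⟩ := norm_le_of_regular_singular hR hN1 (M := ‖B c‖ + 1) (by positivity)
    (fun z hz => (hball hz).1.1.le.trans hN) (fun z hz => (hball hz).1.2.le)
    (fun z hz hzc => (hball hz).2 hzc)
  have hmem : Metric.closedBall c R ∈ 𝓝 c := Metric.closedBall_mem_nhds c hR
  -- Lowering the pole order: `ω = (z - c)^(n+1) w` solves an equation of the same type with
  -- coefficient `n + 1 + A`. The indicial relation gives `(n + 1 + A c) ω(c) = 0`, so `ω(c) = 0`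
  -- and one factor `z - c` can be divided out.
  have hpole : ∀ n : ℕ, (∃ ω : ℂ → ℂ, AnalyticAt ℂ ω c ∧
      ∀ᶠ z in 𝓝[≠] c, (z - c) ^ n * w z = ω z) → ∃ ω : ℂ → ℂ, AnalyticAt ℂ ω c ∧
      ∀ᶠ z in 𝓝[≠] c, w z = ω z := by
    intro n
    induction n with
    | zero => simp
    | succ n ih =>
      rintro ⟨ω, hω, hωw⟩
      apply ih
      have hev : ∀ᶠ z in 𝓝[≠] c, (z - c) * deriv ω z =
          (n + 1 + A z) * ω z + (z - c) ^ (n + 1) * B z := by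
        have h2 : ∀ᶠ z in 𝓝[≠] c, ∀ᶠ y in 𝓝 z, (y - c) ^ (n + 1) * w y = ω y := by
          have := eventually_eventually_nhdsWithin.2 hωw
          filter_upwards [this, self_mem_nhdsWithin] with z hz hzc
          rwa [isOpen_compl_singleton.nhdsWithin_eq hzc] at hz
        filter_upwards [hw, h2, self_mem_nhdsWithin] with z hz hz2 hzc
        have hzc' : z - c ≠ 0 := sub_ne_zero.2 hzc
        have h3 : HasDerivAt (fun y => (y - c) ^ (n + 1) * w y) _ z :=
          ((((hasDerivAt_id z).sub_const c).pow (n + 1)).mul hz)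
        have h4 := (h3.congr_of_eventuallyEq (hz2.mono fun y hy => hy.symm)).deriv
        rw [h4, ← hz2.self_of_nhds]
        simp only [id_eq, Nat.add_sub_cancel, Nat.cast_add, Nat.cast_one, Pi.pow_apply]
        field_simp
        ring
      have h0 := indicial_eq_zero (A := fun z => n + 1 + A z) (B := fun z => (z - c) ^ (n + 1) * B z)
        hω (continuousAt_const.add hA) (ContinuousAt.mul (by fun_prop) hB)
        (nhdsWithin_le_nhds (s := {c}ᶜ)) hev
      have hω0 : ω c = 0 := by
        simp only [sub_self, ne_eq, Nat.succ_ne_zero, not_false_eq_true, zero_pow, zero_mul,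
          add_zero, mul_eq_zero] at h0
        refine h0.resolve_left fun h => hAc n ?_
        linear_combination h
      obtain ⟨p, hp⟩ := hω
      refine ⟨dslope ω c, ⟨_, hp.has_fpower_series_dslope_fslope⟩, ?_⟩
      filter_upwards [hωw, self_mem_nhdsWithin] with z hz hzc
      have hzc' : z - c ≠ 0 := sub_ne_zero.2 hzc
      rw [dslope_of_ne _ hzc, slope_def_field, hω0, sub_zero, ← hz]
      field_simp
      ring
  refine hpole N ?_
  have hdiff : DifferentiableOn ℂ (fun z => (z - c) ^ N * w z) (Metric.closedBall c R \ {c}) :=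
    fun z hz => (DifferentiableAt.mul (by fun_prop)
      ((hball hz.1).2 hz.2).differentiableAt).differentiableWithinAt
  have hext := differentiableOn_update_limUnder_of_bddAbove hmem hdiff ⟨D * R ^ N, by
    rintro _ ⟨z, hz, rfl⟩
    have hn : 0 < ‖z - c‖ := norm_pos_iff.2 (sub_ne_zero.2 hz.2)
    have := hD z hz.1 hz.2
    simp only [Function.comp, norm_mul, norm_pow]
    calc ‖z - c‖ ^ N * ‖w z‖ ≤ ‖z - c‖ ^ N * (D * (R / ‖z - c‖) ^ (N : ℝ)) := by gcongr
      _ = D * R ^ N := by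
        rw [Real.rpow_natCast, div_pow]
        field_simp⟩
  refine ⟨_, (hext.analyticAt hmem), ?_⟩
  filter_upwards [self_mem_nhdsWithin] with z hz
  rw [Function.update_of_ne hz]

/-! ### Improper integrals -/

/-- Contours are differentiable only off a finite set, so constancy rests on the fundamental theorem
of calculus with a countable exceptional set. -/
theorem const_of_hasDerivAt_zero_off_finite {D : ℝ → ℂ} (hD : Continuous D) {S : Set ℝ}
    (hS : S.Finite) (h : ∀ t ∉ S, HasDerivAt D 0 t) (a b : ℝ) : D a = D b := by
  have := MeasureTheory.integral_eq_of_hasDerivAt_off_countable D (fun _ => 0) (a := a) (b := b)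
    hS.countable hD.continuousOn (fun x hx => h x hx.2) (by simp)
  simp only [intervalIntegral.integral_zero] at this
  exact (sub_eq_zero.1 this.symm).symm

theorem integral_eq_sub_of_hasDerivAt_off_finite {Y y : ℝ → ℂ} (hY : Continuous Y) {S : Set ℝ}
    (hS : S.Finite) (h : ∀ t ∉ S, HasDerivAt Y (y t) t) (hy : MeasureTheory.Integrable y) {l r : ℂ}
    (hl : Tendsto Y atBot (𝓝 l)) (hr : Tendsto Y atTop (𝓝 r)) : ∫ t, y t = r - l := by
  have h1 : Tendsto (fun T : ℝ => ∫ t in (-T)..T, y t) atTop (𝓝 (∫ t, y t)) :=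
    MeasureTheory.intervalIntegral_tendsto_integral hy tendsto_neg_atTop_atBot tendsto_id
  have h2 : Tendsto (fun T : ℝ => Y T - Y (-T)) atTop (𝓝 (r - l)) :=
    hr.sub (hl.comp tendsto_neg_atTop_atBot)
  refine tendsto_nhds_unique h1 (h2.congr fun T => ?_)
  exact (MeasureTheory.integral_eq_of_hasDerivAt_off_countable Y y hS.countable hY.continuousOn
    (fun x hx => h x hx.2) hy.intervalIntegrable).symm

/-- Convergence of the primitive along the negative half-line. -/
theorem exists_tendsto_atBot_of_hasDerivAt_off_finite {Y y : ℝ → ℂ} (hY : Continuous Y) {S : Set ℝ}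
    (hS : S.Finite) (h : ∀ t ∉ S, HasDerivAt Y (y t) t) (hy : MeasureTheory.Integrable y) :
    ∃ l, Tendsto Y atBot (𝓝 l) := by
  have h1 := MeasureTheory.intervalIntegral_tendsto_integral_Iic (0 : ℝ) hy.integrableOn tendsto_id
  refine ⟨Y 0 - _, (tendsto_const_nhds.sub h1).congr fun T => ?_⟩
  rw [MeasureTheory.integral_eq_of_hasDerivAt_off_countable Y y hS.countable hY.continuousOn
    (fun x hx => h x hx.2) hy.intervalIntegrable]
  simp

/-- Made for a contour that arrives at time `0`: decay at `-∞`, boundedness just before the arrival,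
compactness in between. -/
theorem integrableOn_Iio_zero_of_exp_bound {φ : ℝ → ℂ} (hφ : ContinuousOn φ (Iio 0)) {η M₁ M₂ : ℝ}
    (hη : 0 < η) (h1 : ∀ᶠ t in atBot, ‖φ t‖ ≤ M₁ * Real.exp (η * t))
    (h2 : ∀ᶠ t in 𝓝[<] (0 : ℝ), ‖φ t‖ ≤ M₂) : MeasureTheory.IntegrableOn φ (Iio 0) := by
  obtain ⟨T, hT⟩ := eventually_atBot.1 h1
  obtain ⟨s, hs, hsφ⟩ := mem_nhdsLT_iff_exists_Ioo_subset.1 h2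
  have hs0 : s < 0 := hs
  obtain ⟨M₃, hM₃⟩ := (isCompact_Icc (a := T) (b := s)).exists_bound_of_continuousOn
    (hφ.mono fun t ht => lt_of_le_of_lt ht.2 hs0)
  -- One exponential dominates everywhere, because `exp (-(η * T)) * exp (η * t) ≥ 1` for `t ≥ T`.
  have hint : MeasureTheory.IntegrableOn (fun t => (|M₁| + (|M₂| + |M₃|) * Real.exp (-(η * T))) *
      Real.exp (η * t)) (Iio 0) :=
    ((integrableOn_exp_mul_Iic hη 0).mono_set Iio_subset_Iic_self).const_mul _
  refine hint.mono' (hφ.aestronglyMeasurable measurableSet_Iio) ?_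
  refine (MeasureTheory.ae_restrict_iff' measurableSet_Iio).2 (Eventually.of_forall fun t ht => ?_)
  have ht0 : t < 0 := ht
  have e1 := Real.exp_pos (η * t)
  have e2 := Real.exp_pos (-(η * T))
  by_cases hc : t ≤ T
  · refine (hT t hc).trans (mul_le_mul_of_nonneg_right ?_ e1.le)
    have : 0 ≤ (|M₂| + |M₃|) * Real.exp (-(η * T)) := by positivity
    linarith [le_abs_self M₁]
  · have h3 : ‖φ t‖ ≤ |M₂| + |M₃| := by
      by_cases hts : t ≤ s
      · exact (hM₃ t ⟨(not_le.1 hc).le, hts⟩).trans (by linarith [le_abs_self M₃, abs_nonneg M₂])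
      · have : ‖φ t‖ ≤ M₂ := hsφ ⟨not_le.1 hts, ht0⟩
        linarith [le_abs_self M₂, abs_nonneg M₃]
    have h4 : 1 ≤ Real.exp (-(η * T)) * Real.exp (η * t) := by
      rw [← Real.exp_add]
      refine Real.one_le_exp ?_
      nlinarith [not_le.1 hc]
    calc ‖φ t‖ ≤ (|M₂| + |M₃|) * 1 := by linarith
      _ ≤ (|M₂| + |M₃|) * (Real.exp (-(η * T)) * Real.exp (η * t)) := by gcongr
      _ ≤ (|M₁| + (|M₂| + |M₃|) * Real.exp (-(η * T))) * Real.exp (η * t) := by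
        nlinarith [mul_nonneg (abs_nonneg M₁) e1.le]

theorem integrable_of_exp_bounds {φ : ℝ → ℂ} (hφ : Continuous φ) {η₁ η₂ M₁ M₂ : ℝ} (h₁ : 0 < η₁)
    (h₂ : 0 < η₂) (hb : ∀ᶠ t in atBot, ‖φ t‖ ≤ M₁ * Real.exp (η₁ * t))
    (ht : ∀ᶠ t in atTop, ‖φ t‖ ≤ M₂ * Real.exp (-(η₂ * t))) : MeasureTheory.Integrable φ := by
  have key : ∀ {ψ : ℝ → ℂ} {η M : ℝ}, Continuous ψ → 0 < η →
      (∀ᶠ t in atBot, ‖ψ t‖ ≤ M * Real.exp (η * t)) → MeasureTheory.IntegrableOn ψ (Iio 0) := by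
    intro ψ η M hψ hη h
    refine integrableOn_Iio_zero_of_exp_bound hψ.continuousOn hη h (M₂ := ‖ψ 0‖ + 1) ?_
    refine (Filter.Eventually.mono ?_ fun t ht => le_of_lt ht).filter_mono nhdsWithin_le_nhds
    exact hψ.norm.continuousAt.eventually_lt continuousAt_const (lt_add_one _)
  have hneg : MeasureTheory.IntegrableOn (fun t => φ (-t)) (Iio (-0)) := by
    rw [neg_zero]
    refine key (hφ.comp continuous_neg) h₂ (M := M₂) ?_
    filter_upwards [tendsto_neg_atBot_atTop.eventually ht] with t ht
    simpa using ht
  have hpos : MeasureTheory.IntegrableOn φ (Ioi 0) := by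
    have := hneg.comp_neg_Ioi
    simp only [neg_neg] at this
    exact this
  rw [← MeasureTheory.integrableOn_univ, ← Iic_union_Ioi (a := (0 : ℝ))]
  exact ((integrableOn_Iic_iff_integrableOn_Iio).2 (key hφ h₁ hb)).union hpos

end BenjaminOno

namespace BenjaminOno

open Complex Set Filter Topology

namespace RationalPotential

variable {P : ℕ} (u : RationalPotential P)

/-! ### The cut plane -/

theorem mul_sub_mem_slitPlane_iff (x w : ℂ) :
    I * (x - w) ∈ slitPlane ↔ (x.re = w.re → x.im < w.im) := by
  rw [mem_slitPlane_iff]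
  simp only [mul_re, I_re, sub_re, zero_mul, I_im, sub_im, one_mul, zero_sub, mul_im, zero_add]
  constructor
  · rintro (h | h) h'
    · linarith
    · exact absurd (sub_eq_zero.2 h') (by simpa using h)
  · intro h
    by_cases h' : x.re = w.re
    · exact Or.inl (by linarith [h h'])
    · exact Or.inr (by simpa using sub_ne_zero.2 h')

theorem neg_mul_sub_conj_mem_slitPlane_iff (x w : ℂ) :
    -I * (x - (starRingEnd ℂ) w) ∈ slitPlane ↔ (x.re = w.re → -w.im < x.im) := by
  rw [mem_slitPlane_iff]
  simp only [neg_mul, neg_re, mul_re, I_re, sub_re, zero_mul, I_im, sub_im, one_mul, zero_sub,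
    neg_im, mul_im, zero_add, conj_re, conj_im]
  constructor
  · rintro (h | h) h'
    · linarith
    · exact absurd (sub_eq_zero.2 h'.symm) (by simpa using h)
  · intro h
    by_cases h' : x.re = w.re
    · exact Or.inl (by linarith [h h'])
    · exact Or.inr (by simpa using sub_ne_zero.2 (Ne.symm h'))

theorem mem_G_iff {x : ℂ} : x ∈ u.G ↔ ∀ p, x.re = (u.z p).re → |x.im| < (u.z p).im := by
  simp only [G, mem_ofPred_eq, mul_sub_mem_slitPlane_iff, neg_mul_sub_conj_mem_slitPlane_iff, abs_lt]
  exact forall_congr' fun p => ⟨fun h e => ⟨h.2 e, h.1 e⟩, fun h => ⟨fun e => (h e).2, fun e => (h e).1⟩⟩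

theorem isOpen_G : IsOpen u.G := by
  have : u.G = ⋂ p, {x | I * (x - u.z p) ∈ slitPlane ∧
      -I * (x - (starRingEnd ℂ) (u.z p)) ∈ slitPlane} := by
    ext x; simp [G]
  rw [this]
  exact isOpen_iInter_of_finite fun p =>
    (isOpen_slitPlane.preimage (by fun_prop)).inter (isOpen_slitPlane.preimage (by fun_prop))

theorem mem_G_of_re_ne {x : ℂ} (h : ∀ p, x.re ≠ (u.z p).re) : x ∈ u.G :=
  u.mem_G_iff.2 fun p hp => absurd hp (h p)

theorem mem_G_of_mem_G₀ {x : ℂ} (h : x ∈ u.G₀) : x ∈ u.G :=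
  u.mem_G_of_re_ne fun p => (h p).ne

theorem ne_z_of_mem_G {x : ℂ} (h : x ∈ u.G) (p : Fin P) : x ≠ u.z p := by
  rintro rfl
  have := u.mem_G_iff.1 h p rfl
  rw [abs_of_pos (u.im_z_pos p)] at this
  exact lt_irrefl _ this

theorem ne_conj_z_of_im_pos {x : ℂ} (h : 0 < x.im) (p : Fin P) : x ≠ (starRingEnd ℂ) (u.z p) := by
  rintro rfl
  rw [conj_im] at h
  linarith [u.im_z_pos p]

/-- The open vertical strip around `x` bounded by the nearest lines `Re y = Re z_j` that do not
contain `x`. -/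
def stripAt (x : ℂ) : Set ℂ :=
  {y | ∀ j, (x.re < (u.z j).re → y.re < (u.z j).re) ∧ ((u.z j).re < x.re → (u.z j).re < y.re)}

theorem stripAt_eq (x : ℂ) : u.stripAt x =
    ⋂ j, ((⋂ _ : x.re < (u.z j).re, {y : ℂ | y.re < (u.z j).re}) ∩
      ⋂ _ : (u.z j).re < x.re, {y : ℂ | (u.z j).re < y.re}) := by
  ext y
  simp [stripAt]

theorem isOpen_stripAt (x : ℂ) : IsOpen (u.stripAt x) := by
  rw [stripAt_eq]
  refine isOpen_iInter_of_finite fun j => IsOpen.inter ?_ ?_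
  · exact isOpen_iInter_of_finite fun _ => isOpen_lt continuous_re continuous_const
  · exact isOpen_iInter_of_finite fun _ => isOpen_lt continuous_const continuous_re

theorem convex_stripAt (x : ℂ) : Convex ℝ (u.stripAt x) := by
  rw [stripAt_eq]
  exact convex_iInter fun j => (convex_iInter fun _ => convex_halfSpace_re_lt _).inter
    (convex_iInter fun _ => convex_halfSpace_re_gt _)

theorem self_mem_stripAt (x : ℂ) : x ∈ u.stripAt x := fun _ => ⟨id, id⟩

theorem re_eq_of_mem_stripAt {x y : ℂ} (h : y ∈ u.stripAt x) {j : Fin P}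
    (hj : y.re = (u.z j).re) : x.re = (u.z j).re := by
  rcases lt_trichotomy x.re (u.z j).re with h1 | h1 | h1
  · exact absurd hj ((h j).1 h1).ne
  · exact h1
  · exact absurd hj ((h j).2 h1).ne'

theorem eq_of_mem_stripAt_z {p j : Fin P} {y : ℂ} (h : y ∈ u.stripAt (u.z p))
    (hj : y.re = (u.z j).re) : j = p :=
  u.re_z_strictMono.injective (u.re_eq_of_mem_stripAt h hj).symm

theorem exists_pos_le_im : ∃ η > 0, ∀ p, η ≤ (u.z p).im := by
  rcases isEmpty_or_nonempty (Fin P) with h | h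
  · exact ⟨1, one_pos, fun p => h.elim p⟩
  · obtain ⟨q, hq⟩ := Finite.exists_min fun p => (u.z p).im
    exact ⟨_, u.im_z_pos q, hq⟩

theorem exists_lt_re : ∃ b : ℝ, ∀ p, b < (u.z p).re := by
  obtain ⟨b, hb⟩ := (finite_range fun p => (u.z p).re).bddBelow
  exact ⟨b - 1, fun p => by linarith [hb (mem_range_self p)]⟩

/-- Holomorphic functions on the cut plane have primitives. -/
theorem exists_primitive_G {g : ℂ → ℂ} (hg : DifferentiableOn ℂ g u.G) :
    ∃ F : ℂ → ℂ, ∀ x ∈ u.G, HasDerivAt F (g x) x := by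
  obtain ⟨η, hη, hηz⟩ := u.exists_pos_le_im
  have hset : ∀ a : ℝ, Convex ℝ {y : ℂ | |y.im| < a} ∧ IsOpen {y : ℂ | |y.im| < a} := by
    intro a
    constructor
    · have : {y : ℂ | |y.im| < a} = {y : ℂ | -a < y.im} ∩ {y : ℂ | y.im < a} := by
        ext; simp [abs_lt]
      rw [this]
      exact (convex_halfSpace_im_gt _).inter (convex_halfSpace_im_lt _)
    · exact isOpen_lt (continuous_abs.comp continuous_im) continuous_const
  -- The common strip stays below every pole. The box of `x` is a full vertical strip, truncated at
  -- height `Im z_j` only if `x` lies between `z_j^*` and `z_j`.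
  refine exists_primitive_of_boxes (U := u.G) (H := {y | |y.im| < η})
    (fun x => u.stripAt x ∩ ⋂ j, ⋂ _ : x.re = (u.z j).re, {y : ℂ | |y.im| < (u.z j).im})
    (hset η).1 (hset η).2 ?_ (fun r => by simpa using hη) ?_ hg
  · intro y hy
    exact u.mem_G_iff.2 fun p _ => lt_of_lt_of_le hy (hηz p)
  · intro x hx
    refine ⟨(u.convex_stripAt x).inter (convex_iInter fun j => convex_iInter fun _ => (hset _).1),
      (u.isOpen_stripAt x).inter (isOpen_iInter_of_finite fun j => isOpen_iInter_of_finite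
        fun _ => (hset _).2), ⟨u.self_mem_stripAt x, ?_⟩, ?_, ?_⟩
    · simpa using fun j => u.mem_G_iff.1 hx j
    · rintro y ⟨h1, h2⟩
      simp only [mem_iInter, mem_ofPred_eq] at h2
      exact u.mem_G_iff.2 fun p hp => h2 p (u.re_eq_of_mem_stripAt h1 hp)
    · rintro y ⟨h1, h2⟩
      refine ⟨fun j => by simpa using h1 j, ?_⟩
      simpa using fun j _ => u.im_z_pos j

/-- A convex neighbourhood of the upper cut of `z_p`. -/
def aboveStrip (p : Fin P) : Set ℂ := u.stripAt (u.z p) ∩ {y | (u.z p).im < y.im}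

theorem isOpen_aboveStrip (p : Fin P) : IsOpen (u.aboveStrip p) :=
  (u.isOpen_stripAt _).inter (isOpen_lt continuous_const continuous_im)

theorem convex_aboveStrip (p : Fin P) : Convex ℝ (u.aboveStrip p) :=
  (u.convex_stripAt _).inter (convex_halfSpace_im_gt _)

theorem upperCut_subset_aboveStrip (p : Fin P) : u.upperCut p ⊆ u.aboveStrip p := by
  rintro y ⟨h1, h2⟩
  refine ⟨fun j => ?_, h2⟩
  rw [h1]
  exact ⟨id, id⟩

theorem mem_G_of_mem_stripAt_z {p : Fin P} {y : ℂ} (h : y ∈ u.stripAt (u.z p))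
    (hre : y.re = (u.z p).re → |y.im| < (u.z p).im) : y ∈ u.G := by
  refine u.mem_G_iff.2 fun j hj => ?_
  obtain rfl := u.eq_of_mem_stripAt_z h hj
  exact hre hj

theorem mem_G_of_mem_aboveStrip {p : Fin P} {y : ℂ} (h : y ∈ u.aboveStrip p)
    (hre : y.re ≠ (u.z p).re) : y ∈ u.G :=
  u.mem_G_of_mem_stripAt_z h.1 fun h => absurd h hre

theorem upperCut_disjoint_G {p : Fin P} {y : ℂ} (h : y ∈ u.upperCut p) : y ∉ u.G := by
  intro hG
  have := (abs_lt.1 (u.mem_G_iff.1 hG p h.1)).2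
  linarith [h.2]

theorem upperCut_unique {p j : Fin P} {y : ℂ} (h : y ∈ u.upperCut p) (h' : y ∈ u.upperCut j) :
    j = p :=
  u.re_z_strictMono.injective (h'.1.symm.trans h.1)

theorem im_pos_of_mem_aboveStrip {p : Fin P} {y : ℂ} (h : y ∈ u.aboveStrip p) : 0 < y.im :=
  (u.im_z_pos p).trans h.2

theorem ne_z_of_mem_aboveStrip {p : Fin P} {y : ℂ} (h : y ∈ u.aboveStrip p) (j : Fin P) :
    y ≠ u.z j := by
  rintro rfl
  obtain rfl := u.eq_of_mem_stripAt_z h.1 rfl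
  exact lt_irrefl _ (show (u.z j).im < (u.z j).im from h.2)

theorem mem_G_or_mem_upperCut {x : ℂ} (hx : 0 < x.im) (hz : ∀ p, x ≠ u.z p) :
    x ∈ u.G ∨ ∃ p, x ∈ u.upperCut p := by
  by_contra! h
  obtain ⟨h1, h2⟩ := h
  refine h1 (u.mem_G_iff.2 fun p hp => ?_)
  rw [abs_of_pos hx]
  by_contra! h3
  rcases h3.eq_or_lt with h4 | h4
  · exact hz p (Complex.ext hp h4.symm)
  · exact h2 p ⟨hp, h4⟩

/-! ### The logarithmic potential -/

/-- The function `f` with the logarithms `Log (i (x - z_p))` replaced by `L p x`. -/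
noncomputable def fWith (L : Fin P → ℂ → ℂ) (x : ℂ) : ℂ :=
  ∑ p, (u.c p * (L p x + Real.pi * I / 2) +
    (starRingEnd ℂ) (u.c p) *
      (Complex.log (-I * (x - (starRingEnd ℂ) (u.z p))) - Real.pi * I / 2))

theorem f_eq_fWith : u.f = u.fWith fun p x => Complex.log (I * (x - u.z p)) := rfl

theorem hasDerivAt_log_mul_sub {a w x : ℂ} (ha : a ≠ 0) (h : a * (x - w) ∈ slitPlane) :
    HasDerivAt (fun y => Complex.log (a * (y - w))) (1 / (x - w)) x := by
  have h1 : HasDerivAt (fun y => a * (y - w)) (a * 1) x := ((hasDerivAt_id x).sub_const w).const_mul a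
  refine (h1.clog h).congr_deriv ?_
  have : x - w ≠ 0 := fun h0 => by simp [h0] at h
  field_simp

theorem hasDerivAt_fWith {L : Fin P → ℂ → ℂ} {d : Fin P → ℂ} {x : ℂ}
    (hL : ∀ p, HasDerivAt (L p) (d p) x)
    (hx : ∀ p, -I * (x - (starRingEnd ℂ) (u.z p)) ∈ slitPlane) :
    HasDerivAt (u.fWith L)
      (∑ p, (u.c p * d p + (starRingEnd ℂ) (u.c p) / (x - (starRingEnd ℂ) (u.z p)))) x := by
  refine HasDerivAt.fun_sum fun p _ => ?_
  refine HasDerivAt.add (((hL p).add_const _).const_mul _) ?_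
  refine (((hasDerivAt_log_mul_sub (by simp) (hx p)).sub_const _).const_mul _).congr_deriv ?_
  ring

theorem hasDerivAt_f {x : ℂ} (hx : x ∈ u.G) : HasDerivAt u.f (u.u₀ x) x := by
  rw [f_eq_fWith]
  refine (u.hasDerivAt_fWith (d := fun p => 1 / (x - u.z p))
    (fun p => hasDerivAt_log_mul_sub I_ne_zero (hx p).1) fun p => (hx p).2).congr_deriv ?_
  simp only [u₀, mul_one_div]

/-- Exchanging one logarithm serves twice: to continue `f` across a cut, and to split off the
singular term of `f` at a pole. -/
theorem fWith_update_sub (L : Fin P → ℂ → ℂ) (p : Fin P) (l : ℂ → ℂ) (x : ℂ) :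
    u.fWith (Function.update L p l) x = u.fWith L x + u.c p * (l x - L p x) := by
  rw [← sub_eq_iff_eq_add', fWith, fWith, ← Finset.sum_sub_distrib]
  rw [Finset.sum_eq_single p]
  · simp only [Function.update_self]; ring
  · intro j _ hj
    simp [Function.update_of_ne hj]
  · simp

theorem neg_mul_sub_conj_mem_slitPlane_of_im_pos {x : ℂ} (hx : 0 < x.im) (p : Fin P) :
    -I * (x - (starRingEnd ℂ) (u.z p)) ∈ slitPlane :=
  (neg_mul_sub_conj_mem_slitPlane_iff _ _).2 fun _ => by linarith [u.im_z_pos p]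

theorem mul_sub_mem_slitPlane_of_mem_stripAt {p j : Fin P} {x : ℂ} (hx : x ∈ u.stripAt (u.z p))
    (hj : j ≠ p) : I * (x - u.z j) ∈ slitPlane :=
  (mul_sub_mem_slitPlane_iff _ _).2 fun h => absurd (u.eq_of_mem_stripAt_z hx h) hj

end RationalPotential

/-! ### Jumps across the upper cuts -/

/-- `F` is a primitive of `F'` on the cut plane; continued from the right across the upper cut of
`z_p`, it becomes `q p * F + κ p`. The values on the cuts are the limits from the right. -/
structure HasJumps {P : ℕ} (u : RationalPotential P) (F F' : ℂ → ℂ) (q κ : Fin P → ℂ) : Prop where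
  hasDerivAt : ∀ x ∈ u.G, HasDerivAt F (F' x) x
  jump : ∀ p, ∃ R R' : ℂ → ℂ, ∀ x ∈ u.aboveStrip p, HasDerivAt R (R' x) x ∧
    ((u.z p).re ≤ x.re → R x = F x ∧ R' x = F' x) ∧
    (x.re < (u.z p).re → R x = q p * F x + κ p)

namespace RationalPotential

variable {P : ℕ} (u : RationalPotential P)

/-- For `Im y > 0` the point `-iy` is in the right half-plane, so `Log(-iy) + πi` is a branch of
`log(iy)` analytic across the cut. On the cut itself `Log(iy)` has argument `π`, the limit from the
right; hence the closed condition `0 ≤ y.re`. -/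
theorem log_neg_add_pi {y : ℂ} (him : 0 < y.im) :
    (0 ≤ y.re → Complex.log (-I * y) + Real.pi * I = Complex.log (I * y)) ∧
    (y.re < 0 → Complex.log (-I * y) + Real.pi * I = Complex.log (I * y) + 2 * Real.pi * I) := by
  have hre : 0 < (-I * y).re := by simpa using him
  have hy : -I * y ≠ 0 := fun h => by simp [h] at hre
  have e1 : Complex.exp (Complex.log (-I * y) + Real.pi * I) = I * y := by
    rw [Complex.exp_add, Complex.exp_log hy, Complex.exp_pi_mul_I]
    ring
  have harg := Complex.abs_arg_lt_pi_div_two_iff.2 (Or.inl hre)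
  rw [abs_lt] at harg
  have hpi : (Real.pi * I : ℂ).im = Real.pi := by simp
  constructor
  · intro h0
    have him' : (-I * y).im ≤ 0 := by simpa using h0
    have ha : Complex.arg (-I * y) ≤ 0 := by
      by_contra! hc
      have h2 := (Complex.arg_nonneg_iff.1 hc.le)
      have h3 : (-I * y).im = 0 := le_antisymm him' h2
      rw [Complex.arg_eq_zero_iff.2 ⟨hre.le, h3⟩] at hc
      exact lt_irrefl _ hc
    rw [← e1, Complex.log_exp]
    · rw [add_im, log_im, hpi]; linarith [Real.pi_pos]
    · rw [add_im, log_im, hpi]; linarith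
  · intro h0
    have him' : 0 < (-I * y).im := by simpa using h0
    have ha : 0 < Complex.arg (-I * y) := by
      have h2 := Complex.arg_nonneg_iff.2 him'.le
      refine lt_of_le_of_ne h2 fun h => ?_
      rw [eq_comm, Complex.arg_eq_zero_iff] at h
      exact him'.ne' h.2
    have e2 : Complex.exp (Complex.log (-I * y) - Real.pi * I) = I * y := by
      rw [Complex.exp_sub, Complex.exp_log hy, Complex.exp_pi_mul_I]
      ring
    have : Complex.log (I * y) = Complex.log (-I * y) - Real.pi * I := by
      rw [← e2, Complex.log_exp]
      · rw [sub_im, log_im, hpi]; linarith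
      · rw [sub_im, log_im, hpi]; linarith [Real.pi_pos]
    rw [this]
    ring

theorem hasJumps_f : HasJumps u u.f u.u₀ 1 fun p => 2 * Real.pi * I * u.c p := by
  refine ⟨fun x hx => u.hasDerivAt_f hx, fun p => ?_⟩
  refine ⟨u.fWith (Function.update (fun p x => Complex.log (I * (x - u.z p))) p
    fun x => Complex.log (-I * (x - u.z p)) + Real.pi * I), u.u₀, fun x hx => ⟨?_, ?_, ?_⟩⟩
  · refine (u.hasDerivAt_fWith (d := fun p => 1 / (x - u.z p)) (fun j => ?_) fun p =>
      u.neg_mul_sub_conj_mem_slitPlane_of_im_pos (u.im_pos_of_mem_aboveStrip hx) p).congr_deriv ?_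
    · by_cases hj : j = p
      · subst hj
        rw [Function.update_self]
        refine (hasDerivAt_log_mul_sub (by simp) ?_).add_const _
        refine mem_slitPlane_iff.2 (Or.inl ?_)
        simpa using hx.2
      · rw [Function.update_of_ne hj]
        exact hasDerivAt_log_mul_sub I_ne_zero (u.mul_sub_mem_slitPlane_of_mem_stripAt hx.1 hj)
    · simp only [u₀, mul_one_div]
  · intro hre
    have := (log_neg_add_pi (y := x - u.z p) (by simpa using hx.2)).1 (by simpa using hre)
    rw [fWith_update_sub, this, ← f_eq_fWith, sub_self, mul_zero, add_zero]
    exact ⟨rfl, rfl⟩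
  · intro hre
    have := (log_neg_add_pi (y := x - u.z p) (by simpa using hx.2)).2 (by simpa using hre)
    rw [fWith_update_sub, this, ← f_eq_fWith]
    simp only [Pi.one_apply]
    ring

/-! ### Decay of `f` at `-i∞` -/

/-- When both arguments are in the right half-plane, the difference of the arguments is in `(-π,
π)`, so the difference of logarithms is exactly `Log(1 + d/w)`. -/
theorem tendsto_log_sub_log (d : ℂ) : Tendsto
    (fun w : ℂ => Complex.log (w + d) - Complex.log w)
    (comap norm atTop ⊓ 𝓟 {w | 0 < w.re ∧ 0 < (w + d).re}) (𝓝 0) := by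
  have h1 : Tendsto (fun w : ℂ => 1 + d / w) (comap norm atTop) (𝓝 1) := by
    have : Tendsto (fun w : ℂ => w⁻¹) (comap norm atTop) (𝓝 0) := by
      rw [tendsto_zero_iff_norm_tendsto_zero]
      simp only [norm_inv]
      exact tendsto_inv_atTop_zero.comp tendsto_comap
    simpa [div_eq_mul_inv] using (this.const_mul d).const_add 1
  have h2 := ((continuousAt_clog one_mem_slitPlane).tendsto.comp h1)
  rw [Complex.log_one] at h2
  refine (h2.mono_left inf_le_left).congr' ?_
  filter_upwards [mem_inf_of_right (mem_principal_self _)] with w hw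
  have hw0 : w ≠ 0 := fun h => by simp [h] at hw
  have hwd : w + d ≠ 0 := fun h => by simp [h] at hw
  have a1 := abs_lt.1 (Complex.abs_arg_lt_pi_div_two_iff.2 (Or.inl hw.1))
  have a2 := abs_lt.1 (Complex.abs_arg_lt_pi_div_two_iff.2 (Or.inl hw.2))
  have e : Complex.exp (Complex.log (w + d) - Complex.log w) = 1 + d / w := by
    rw [Complex.exp_sub, Complex.exp_log hwd, Complex.exp_log hw0]
    field_simp
  simp only [Function.comp]
  rw [← e, Complex.log_exp]
  · simp [Complex.log_im]; linarith
  · simp [Complex.log_im]; linarith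

/-- To the left of all poles the constants `±πi/2` turn each term into the principal `Log(w - x)`,
with `w` the pole or its conjugate. Since the coefficients sum to zero, any common logarithm may be
subtracted, and only differences that decay remain. -/
theorem f_eq_of_mem_G₀ {x : ℂ} (hx : x ∈ u.G₀) (b : ℝ) : u.f x =
    ∑ p, (u.c p * (Complex.log (u.z p - x) - Complex.log (b - x)) +
      (starRingEnd ℂ) (u.c p) *
        (Complex.log ((starRingEnd ℂ) (u.z p) - x) - Complex.log (b - x))) := by
  have key : ∀ w : ℂ, x.re < w.re →
      Complex.log (I * (x - w)) + Real.pi * I / 2 = Complex.log (w - x) ∧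
      Complex.log (-I * (x - w)) - Real.pi * I / 2 = Complex.log (w - x) := by
    intro w hw
    have hre : 0 < (w - x).re := by simpa using hw
    have h0 : w - x ≠ 0 := fun h => by simp [h] at hre
    have a1 := abs_lt.1 (Complex.abs_arg_lt_pi_div_two_iff.2 (Or.inl hre))
    have hI : Complex.exp (Real.pi * I / 2) = I := by
      rw [show (Real.pi * I / 2 : ℂ) = Real.pi / 2 * I by ring, Complex.exp_pi_div_two_mul_I]
    have e1 : Complex.exp (Complex.log (w - x) - Real.pi * I / 2) = I * (x - w) := by
      rw [Complex.exp_sub, Complex.exp_log h0, hI, div_I]; ring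
    have e2 : Complex.exp (Complex.log (w - x) + Real.pi * I / 2) = -I * (x - w) := by
      rw [Complex.exp_add, Complex.exp_log h0, hI]; ring
    have i1 : (Real.pi * I / 2 : ℂ).im = Real.pi / 2 := by
      rw [show (Real.pi * I / 2 : ℂ) = ((Real.pi / 2 : ℝ) : ℂ) * I by push_cast; ring]; simp
    constructor
    · rw [← e1, Complex.log_exp]
      · ring
      · rw [sub_im, i1, log_im]; linarith
      · rw [sub_im, i1, log_im]; linarith
    · rw [← e2, Complex.log_exp]
      · ring
      · rw [add_im, i1, log_im]; linarith
      · rw [add_im, i1, log_im]; linarith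
  have : u.f x = ∑ p, (u.c p * Complex.log (u.z p - x) +
      (starRingEnd ℂ) (u.c p) * Complex.log ((starRingEnd ℂ) (u.z p) - x)) := by
    refine Finset.sum_congr rfl fun p _ => ?_
    rw [(key _ (hx p)).1, (key ((starRingEnd ℂ) (u.z p)) (by simpa using hx p)).2]
  rw [this, ← sub_eq_zero, ← Finset.sum_sub_distrib]
  rw [Finset.sum_congr rfl (g := fun p => (u.c p + (starRingEnd ℂ) (u.c p)) *
    Complex.log (b - x)) fun p _ => by ring]
  rw [← Finset.sum_mul, u.sum_c, zero_mul]

theorem tendsto_f_negI : Tendsto u.f (comap im atBot ⊓ 𝓟 u.G₀) (𝓝 0) := by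
  -- With `b = Re z_1`, the point `b - x` is in the right half-plane for `x ∈ G₀`; for `P = 0` the
  -- sum is empty and `b` is irrelevant.
  have hb : ∃ b : ℝ, ∀ x ∈ u.G₀, 0 < P → x.re < b := by
    by_cases hP : 0 < P
    · exact ⟨(u.z ⟨0, hP⟩).re, fun x hx _ => hx _⟩
    · exact ⟨0, fun x hx h => absurd h hP⟩
  obtain ⟨b, hb⟩ := hb
  have hlog : ∀ w : ℂ, (∀ x ∈ u.G₀, x.re < w.re) → (∀ x ∈ u.G₀, x.re < b) →
      Tendsto (fun x : ℂ => Complex.log (w - x) - Complex.log (b - x))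
      (comap im atBot ⊓ 𝓟 u.G₀) (𝓝 0) := by
    intro w hw hb
    have h1 : Tendsto (fun x : ℂ => (b : ℂ) - x) (comap im atBot ⊓ 𝓟 u.G₀)
        (comap norm atTop ⊓ 𝓟 {y | 0 < y.re ∧ 0 < (y + (w - b)).re}) := by
      refine tendsto_inf.2 ⟨?_, ?_⟩
      · refine tendsto_comap_iff.2 (Tendsto.mono_left ?_ inf_le_left)
        refine tendsto_atTop_mono (f := fun x : ℂ => -x.im) (fun x => ?_)
          (tendsto_neg_atBot_atTop.comp tendsto_comap)
        calc -x.im = ((b : ℂ) - x).im := by simp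
          _ ≤ _ := (le_abs_self _).trans (abs_im_le_norm _)
      · refine tendsto_principal.2 ?_
        filter_upwards [mem_inf_of_right (mem_principal_self _)] with x hx
        have := hb x hx
        have := hw x hx
        simp
        constructor <;> linarith
    refine ((tendsto_log_sub_log (w - b)).comp h1).congr fun x => ?_
    simp only [Function.comp]
    congr 2
    ring
  have hsum : Tendsto (fun x => ∑ p, (u.c p * (Complex.log (u.z p - x) - Complex.log (b - x)) +
      (starRingEnd ℂ) (u.c p) *
        (Complex.log ((starRingEnd ℂ) (u.z p) - x) - Complex.log (b - x))))
      (comap im atBot ⊓ 𝓟 u.G₀) (𝓝 (∑ p : Fin P, (u.c p * 0 + (starRingEnd ℂ) (u.c p) * 0))) := by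
    refine tendsto_finsetSum _ fun p _ => ?_
    have hP : 0 < P := p.pos
    refine ((hlog _ (fun x hx => hx p) (fun x hx => hb x hx hP)).const_mul _).add
      ((hlog _ (fun x hx => by simpa using hx p) (fun x hx => hb x hx hP)).const_mul _)
  simp only [mul_zero, add_zero, Finset.sum_const_zero] at hsum
  refine hsum.congr' ?_
  filter_upwards [mem_inf_of_right (mem_principal_self _)] with x hx
  exact (u.f_eq_of_mem_G₀ hx b).symm

end RationalPotential

end BenjaminOno

/-! ### The weight, its monodromy, and primitives with jumps -/

namespace BenjaminOno

open Complex Set Filter Topology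

variable {P : ℕ} (u : RationalPotential P)

/-- The weight `e^{-ih/ε}` on the cut plane. -/
noncomputable def weight (ε lam : ℝ) (x : ℂ) : ℂ :=
  Complex.exp (-I * (lam * x + u.f x) / ε)

/-- The factor by which the weight is multiplied upon continuation around `z_p`. -/
noncomputable def monodromy (ε : ℝ) (p : Fin P) : ℂ :=
  Complex.exp (-I * (2 * Real.pi * I * u.c p) / ε)

theorem monodromy_ne_zero (ε : ℝ) (p : Fin P) : monodromy u ε p ≠ 0 := Complex.exp_ne_zero _

variable {u}

theorem hasDerivAt_cexp_weight {ε lam : ℝ} {F : ℂ → ℂ} {F' x : ℂ} (h : HasDerivAt F F' x) :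
    HasDerivAt (fun y => Complex.exp (-I * (lam * y + F y) / ε))
      (Complex.exp (-I * (lam * x + F x) / ε) * (-I * (lam + F') / ε)) x := by
  have h1 : HasDerivAt (fun y => -I * (lam * y + F y) / ε) (-I * (lam * 1 + F') / ε) x :=
    ((((hasDerivAt_id x).const_mul (lam : ℂ)).add h).const_mul (-I)).div_const _
  simpa using h1.cexp

theorem hasDerivAt_weight {ε lam : ℝ} {x : ℂ} (hx : x ∈ u.G) :
    HasDerivAt (weight u ε lam) (weight u ε lam x * (-I * (lam + u.u₀ x) / ε)) x :=
  hasDerivAt_cexp_weight (u.hasDerivAt_f hx)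

theorem differentiableAt_ratFactor {μ : ℝ} {v : Fin P → ℂ} {x : ℂ} (hx : ∀ p, x ≠ u.z p) :
    DifferentiableAt ℂ (ratFactor u μ v) x := by
  unfold ratFactor
  refine DifferentiableAt.add_const _ (DifferentiableAt.fun_sum fun p _ => ?_)
  exact (differentiableAt_const _).div (by fun_prop) (sub_ne_zero.2 (hx p))

theorem exists_eq_add_const {S : Set ℂ} (hS : Convex ℝ S) (hSo : IsOpen S) {F H g : ℂ → ℂ}
    (hF : ∀ x ∈ S, HasDerivAt F (g x) x) (hH : ∀ x ∈ S, HasDerivAt H (g x) x) :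
    ∃ a, ∀ x ∈ S, F x = H x + a := by
  rcases S.eq_empty_or_nonempty with rfl | ⟨y, hy⟩
  · simp
  · refine ⟨F y - H y, fun x hx => ?_⟩
    linear_combination sub_eq_sub_of_hasDerivAt hS hSo hF hH hx hy

open scoped Classical in
/-- A primitive of `weight * ratFactor` on the cut plane extends to the upper cuts by its limits
from the right, and it has jumps there. -/
theorem exists_hasJumps {ε lam μ : ℝ} {v : Fin P → ℂ} {Φ₀ : ℂ → ℂ}
    (h : ∀ x ∈ u.G, HasDerivAt Φ₀ (weight u ε lam x * ratFactor u μ v x) x) :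
    ∃ Φ κ, EqOn Φ Φ₀ u.G ∧
      HasJumps u Φ (fun x => weight u ε lam x * ratFactor u μ v x) (monodromy u ε) κ := by
  have key : ∀ p, ∃ (R R' : ℂ → ℂ) (κ : ℂ), ∀ x ∈ u.aboveStrip p, HasDerivAt R (R' x) x ∧
      ((u.z p).re < x.re → R x = Φ₀ x) ∧
      ((u.z p).re ≤ x.re → R' x = weight u ε lam x * ratFactor u μ v x) ∧
      (x.re < (u.z p).re → R x = monodromy u ε p * Φ₀ x + κ) := by
    intro p
    obtain ⟨f, f', hf⟩ := u.hasJumps_f.jump p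
    have hleft : ∀ x ∈ u.aboveStrip p, x.re < (u.z p).re →
        Complex.exp (-I * (lam * x + f x) / ε) = monodromy u ε p * weight u ε lam x := by
      intro x hx hre
      rw [monodromy, weight, ← Complex.exp_add, (hf x hx).2.2 hre]
      congr 1
      simp only [Pi.one_apply]
      ring
    have hright : ∀ x ∈ u.aboveStrip p, (u.z p).re ≤ x.re →
        Complex.exp (-I * (lam * x + f x) / ε) = weight u ε lam x := by
      intro x hx hre
      rw [weight, ((hf x hx).2.1 hre).1]
    obtain ⟨w, hw⟩ : ∃ w : ℂ → ℂ, ∀ x, w x =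
        Complex.exp (-I * (lam * x + f x) / ε) * ratFactor u μ v x := ⟨_, fun _ => rfl⟩
    have hwd : ∀ x ∈ u.aboveStrip p, DifferentiableAt ℂ w x := by
      intro x hx
      rw [funext hw]
      exact (hasDerivAt_cexp_weight (hf x hx).1).differentiableAt.mul
        (differentiableAt_ratFactor (u.ne_z_of_mem_aboveStrip hx))
    obtain ⟨Ψ, hΨ⟩ := exists_primitive_of_convex (u.convex_aboveStrip p) (u.isOpen_aboveStrip p)
      fun x hx => (hwd x hx).differentiableWithinAt
    obtain ⟨a, ha⟩ := exists_eq_add_const (F := Φ₀) (H := Ψ) (g := w)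
      ((u.convex_aboveStrip p).inter (convex_halfSpace_re_gt (u.z p).re))
      ((u.isOpen_aboveStrip p).inter (isOpen_lt continuous_const continuous_re))
      (fun x hx => by
        rw [hw, hright x hx.1 hx.2.le]
        exact h x (u.mem_G_of_mem_aboveStrip hx.1 (ne_of_gt hx.2))) fun x hx => hΨ x hx.1
    obtain ⟨b, hb⟩ := exists_eq_add_const (F := fun x => monodromy u ε p * Φ₀ x) (H := Ψ) (g := w)
      ((u.convex_aboveStrip p).inter (convex_halfSpace_re_lt (u.z p).re))
      ((u.isOpen_aboveStrip p).inter (isOpen_lt continuous_re continuous_const))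
      (fun x hx => by
        rw [hw, hleft x hx.1 hx.2, mul_assoc]
        exact (h x (u.mem_G_of_mem_aboveStrip hx.1 (ne_of_lt hx.2))).const_mul _)
      fun x hx => hΨ x hx.1
    -- On the right `Φ₀ = Ψ + a`, on the left `q_p Φ₀ = Ψ + b`; so the continuation `Ψ + a` from the
    -- right equals `q_p Φ₀ + (a - b)` on the left.
    refine ⟨fun x => Ψ x + a, w, a - b, fun x hx => ⟨(hΨ x hx).add_const _, fun hre => ?_,
      fun hre => ?_, fun hre => ?_⟩⟩
    · exact (ha x ⟨hx, hre⟩).symm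
    · rw [hw, hright x hx hre]
    · rw [hb x ⟨hx, hre⟩]
      ring
  choose R R' κ hR using key
  -- The value `0` concerns only the poles, their conjugates and the lower cuts, where nothing is
  -- claimed.
  refine ⟨fun x => if x ∈ u.G then Φ₀ x else if h : ∃ p, x ∈ u.upperCut p then R h.choose x else 0,
    κ, fun x hx => if_pos hx, fun x hx => ?_, fun p => ⟨R p, R' p, fun x hx => ?_⟩⟩
  · refine (h x hx).congr_of_eventuallyEq ?_
    filter_upwards [u.isOpen_G.mem_nhds hx] with y hy
    exact if_pos hy
  · obtain ⟨h1, h2, h3, h4⟩ := hR p x hx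
    refine ⟨h1, fun hre => ⟨?_, h3 hre⟩, fun hre => ?_⟩
    · rcases hre.eq_or_lt with hre | hre
      · have hcut : x ∈ u.upperCut p := ⟨hre.symm, hx.2⟩
        have hex : ∃ p, x ∈ u.upperCut p := ⟨p, hcut⟩
        simp only [if_neg (u.upperCut_disjoint_G hcut), dif_pos hex]
        rw [u.upperCut_unique hcut hex.choose_spec]
      · simp only [if_pos (u.mem_G_of_mem_aboveStrip hx hre.ne')]
        exact h2 hre
    · simp only [if_pos (u.mem_G_of_mem_aboveStrip hx hre.ne)]
      exact h4 hre

/-! ### Continuation along a path crossing upper cuts -/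

/-- The cuts crossed before time `t`. -/
noncomputable def crossed (s : Finset (Fin P)) (τ : Fin P → ℝ) (t : ℝ) : Finset (Fin P) :=
  s.filter fun p => τ p < t

/-- The additive constant acquired by a function with jumps `q`, `κ` before time `t`. -/
noncomputable def acquired (q κ : Fin P → ℂ) (s : Finset (Fin P)) (τ : Fin P → ℝ) (t : ℝ) : ℂ :=
  ∑ p ∈ crossed s τ t, (∏ j ∈ crossed s τ (τ p), q j) * κ p

/-- The path crosses exactly the upper cuts of the `z_p`, `p ∈ s`, at time `τ p` and from right to
left. -/
structure Crosses (u : RationalPotential P) (γ : ℝ → ℂ) (s : Finset (Fin P)) (τ : Fin P → ℝ) :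
    Prop where
  injOn : InjOn τ s
  mem_cut : ∀ p ∈ s, γ (τ p) ∈ u.upperCut p
  before : ∀ p ∈ s, ∀ᶠ t in 𝓝[<] (τ p), (u.z p).re < (γ t).re
  after : ∀ p ∈ s, ∀ᶠ t in 𝓝[>] (τ p), (γ t).re < (u.z p).re
  mem_G : ∀ t, (∀ p ∈ s, t ≠ τ p) → γ t ∈ u.G

theorem eventually_lt_iff (s : Finset (Fin P)) (τ : Fin P → ℝ) (t₀ : ℝ) :
    ∀ᶠ t in 𝓝 t₀, ∀ p ∈ s, τ p ≠ t₀ → (τ p < t ↔ τ p < t₀) := by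
  refine (Finset.eventually_all s).2 fun p _ => ?_
  rcases lt_trichotomy (τ p) t₀ with h | h | h
  · filter_upwards [lt_mem_nhds h] with t ht _
    exact ⟨fun _ => h, fun _ => ht⟩
  · exact Eventually.of_forall fun t ht => absurd h ht
  · filter_upwards [gt_mem_nhds h] with t ht _
    exact ⟨fun h' => absurd h' ht.not_gt, fun h' => absurd h' h.not_gt⟩

theorem eventually_crossed_eq {s : Finset (Fin P)} {τ : Fin P → ℝ} {t₀ : ℝ}
    (h : ∀ p ∈ s, t₀ ≠ τ p) : ∀ᶠ t in 𝓝 t₀, crossed s τ t = crossed s τ t₀ := by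
  filter_upwards [eventually_lt_iff s τ t₀] with t ht
  exact Finset.filter_congr fun p hp => ht p hp (h p hp).symm

theorem eventually_crossed_eq_ite {s : Finset (Fin P)} {τ : Fin P → ℝ} (hτ : InjOn τ s)
    {p : Fin P} (hp : p ∈ s) : ∀ᶠ t in 𝓝 (τ p), crossed s τ t =
      if τ p < t then insert p (crossed s τ (τ p)) else crossed s τ (τ p) := by
  filter_upwards [eventually_lt_iff s τ (τ p)] with t ht
  ext j
  by_cases hj : j = p
  · subst hj
    split_ifs with h <;> simp [crossed, hp, h]
  · by_cases hjs : j ∈ s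
    · have := ht j hjs fun h => hj (hτ hjs hp h)
      split_ifs with h <;> simp [crossed, hjs, this, hj]
    · split_ifs with h <;> simp [crossed, hjs, hj]

theorem eventually_crossed_eq_empty (s : Finset (Fin P)) (τ : Fin P → ℝ) :
    ∀ᶠ t in atBot, crossed s τ t = ∅ := by
  have : ∀ᶠ t in atBot, ∀ p ∈ s, t ≤ τ p :=
    (Finset.eventually_all s).2 fun p _ => eventually_le_atBot _
  filter_upwards [this] with t ht
  exact Finset.filter_eq_empty_iff.2 fun p hp => (ht p hp).not_gt

theorem eventually_crossed_eq_self (s : Finset (Fin P)) (τ : Fin P → ℝ) :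
    ∀ᶠ t in atTop, crossed s τ t = s := by
  have : ∀ᶠ t in atTop, ∀ p ∈ s, τ p < t :=
    (Finset.eventually_all s).2 fun p _ => eventually_gt_atTop _
  filter_upwards [this] with t ht
  exact Finset.filter_eq_self.2 ht

theorem acquired_congr {q κ : Fin P → ℂ} {s : Finset (Fin P)} {τ : Fin P → ℝ} {t t' : ℝ}
    (h : crossed s τ t = crossed s τ t') : acquired q κ s τ t = acquired q κ s τ t' := by
  rw [acquired, acquired, h]

/-- At the crossing of cut `p`, with `Q` the product of the factors collected so far, `Q R = Q (q_p
F + κ_p)` on the left: the product gains `q_p` and the constant gains `Q κ_p`. The strict inequality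
in `crossed` matches the convention that values on a cut are those from the right. -/
theorem Crosses.continuous_continuation {γ : ℝ → ℂ} {s : Finset (Fin P)} {τ : Fin P → ℝ}
    (hc : Crosses u γ s τ) (hγ : Continuous γ) {F F' : ℂ → ℂ} {q κ : Fin P → ℂ}
    (hF : HasJumps u F F' q κ) :
    Continuous fun t => (∏ p ∈ crossed s τ t, q p) * F (γ t) + acquired q κ s τ t := by
  refine continuous_iff_continuousAt.2 fun t₀ => ?_
  by_cases ht : ∀ p ∈ s, t₀ ≠ τ p
  · have h1 : ContinuousAt (fun t => (∏ p ∈ crossed s τ t₀, q p) * F (γ t) + acquired q κ s τ t₀)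
        t₀ :=
      (continuousAt_const.mul (((hF.hasDerivAt _ (hc.mem_G _ ht)).continuousAt).comp
        hγ.continuousAt)).add continuousAt_const
    refine h1.congr ?_
    filter_upwards [eventually_crossed_eq ht] with t h
    rw [h, acquired_congr h]
  · push Not at ht
    obtain ⟨p, hp, rfl⟩ := ht
    obtain ⟨R, R', hR⟩ := hF.jump p
    have hmem := u.upperCut_subset_aboveStrip p (hc.mem_cut p hp)
    have h1 : ContinuousAt (fun t => (∏ p ∈ crossed s τ (τ p), q p) * R (γ t) +
        acquired q κ s τ (τ p)) (τ p) :=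
      (continuousAt_const.mul (((hR _ hmem).1.continuousAt).comp
        hγ.continuousAt)).add continuousAt_const
    refine h1.congr ?_
    filter_upwards [eventually_crossed_eq_ite hc.injOn hp,
      hγ.continuousAt.preimage_mem_nhds ((u.isOpen_aboveStrip p).mem_nhds hmem),
      eventually_nhdsWithin_iff.1 (hc.before p hp), eventually_nhdsWithin_iff.1 (hc.after p hp)]
      with t h2 h3 h4 h5
    have hnot : p ∉ crossed s τ (τ p) := by simp [crossed]
    rcases lt_trichotomy t (τ p) with h | rfl | h
    · rw [if_neg h.not_gt] at h2
      rw [acquired_congr h2, h2, ((hR _ h3).2.1 (h4 h).le).1]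
    · rw [((hR _ h3).2.1 (hc.mem_cut p hp).1.ge).1]
    · rw [if_pos h] at h2
      rw [acquired, acquired, h2, Finset.prod_insert hnot, Finset.sum_insert hnot,
        (hR _ h3).2.2 (h5 h)]
      ring

theorem Crosses.hasDerivAt_continuation {γ : ℝ → ℂ} {s : Finset (Fin P)} {τ : Fin P → ℝ}
    (hc : Crosses u γ s τ) {F F' : ℂ → ℂ} {q κ : Fin P → ℂ}
    (hF : HasJumps u F F' q κ) {t : ℝ} (ht : ∀ p ∈ s, t ≠ τ p) (hd : DifferentiableAt ℝ γ t) :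
    HasDerivAt (fun t => (∏ p ∈ crossed s τ t, q p) * F (γ t) + acquired q κ s τ t)
      ((∏ p ∈ crossed s τ t, q p) * (F' (γ t) * deriv γ t)) t := by
  have h1 : HasDerivAt (fun t => F (γ t)) (F' (γ t) * deriv γ t) t :=
    (hF.hasDerivAt _ (hc.mem_G _ ht)).comp t hd.hasDerivAt
  refine ((h1.const_mul (∏ p ∈ crossed s τ t, q p)).add_const (acquired q κ s τ t)).congr_of_eventuallyEq ?_
  filter_upwards [eventually_crossed_eq ht] with t' h
  rw [h, acquired_congr h]

theorem IsLoop.exists_crosses {m : Fin P} {C : LiftedContour} (hC : IsLoop u m C) :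
    ∃ τ, Crosses u C.path (Finset.Iic m) τ := by
  obtain ⟨τ, h1, h2, h3⟩ := hC.crossings
  simp only [← Finset.mem_Iic] at h2 h3
  exact ⟨τ, fun a ha b hb => h1.injOn (by simpa using ha) (by simpa using hb), fun p hp => (h2 p hp).1,
    fun p hp => (h2 p hp).2.1, fun p hp => (h2 p hp).2.2, h3⟩

/-! ### Behaviour at `-i∞` -/

theorem StartsAtNegI.tendsto {γ : ℝ → ℂ} (h : StartsAtNegI u γ) :
    Tendsto γ atBot (comap im atBot ⊓ 𝓟 u.G₀) := by
  obtain ⟨δ, hδ, T, hT⟩ := h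
  refine tendsto_inf.2 ⟨tendsto_comap_iff.2 ?_, tendsto_principal.2 ?_⟩
  · refine tendsto_atBot_mono' _ ?_ ((tendsto_const_mul_atBot_of_pos hδ).2 tendsto_id)
    filter_upwards [eventually_le_atBot T] with t ht using (hT t ht).2
  · filter_upwards [eventually_le_atBot T] with t ht using (hT t ht).1

theorem EndsAtNegI.starts {γ : ℝ → ℂ} (h : EndsAtNegI u γ) : StartsAtNegI u fun t => γ (-t) := by
  obtain ⟨δ, hδ, T, hT⟩ := h
  refine ⟨δ, hδ, -T, fun t ht => ?_⟩
  have := hT (-t) (by linarith)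
  simpa using this

/-- The modulus of the weight is `exp((λ Im x + Im f)/ε)`, where `f` is bounded near `-i∞` in `G₀`.
For `Im x ≤ -1` every `|x - z_p|` is at least `1`, which bounds the rational factor. -/
theorem exists_weight_bound {ε lam μ : ℝ} {v : Fin P → ℂ} (hε : 0 < ε) :
    ∃ M : ℝ, ∃ T : ℝ, 0 ≤ M ∧ ∀ x ∈ u.G₀, x.im ≤ T →
      ‖weight u ε lam x * ratFactor u μ v x‖ ≤ M * Real.exp (lam / ε * x.im) := by
  have h1 : ∀ᶠ x in comap im atBot ⊓ 𝓟 u.G₀, ‖u.f x‖ < 1 := by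
    have := u.tendsto_f_negI.norm
    rw [norm_zero] at this
    exact this.eventually_lt_const one_pos
  rw [eventually_inf_principal, eventually_comap, eventually_atBot] at h1
  obtain ⟨T, hT⟩ := h1
  refine ⟨Real.exp (1 / ε) * (∑ p, ‖v p‖ + ‖(μ : ℂ)‖), min T (-1), by positivity,
    fun x hx hxT => ?_⟩
  have hf := hT x.im (hxT.trans (min_le_left _ _)) x rfl hx
  have him : x.im ≤ -1 := hxT.trans (min_le_right _ _)
  have hw : ‖weight u ε lam x‖ ≤ Real.exp (1 / ε) * Real.exp (lam / ε * x.im) := by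
    rw [weight, Complex.norm_exp, ← Real.exp_add, Real.exp_le_exp]
    have : (-I * (lam * x + u.f x) / ε).re = (lam * x.im + (u.f x).im) / ε := by
      rw [div_ofReal_re]
      simp
    rw [this]
    have h2 : (u.f x).im ≤ 1 := (le_abs_self _).trans ((abs_im_le_norm _).trans hf.le)
    have : lam * x.im / ε + (u.f x).im / ε ≤ lam * x.im / ε + 1 / ε := by gcongr
    calc (lam * x.im + (u.f x).im) / ε = lam * x.im / ε + (u.f x).im / ε := by ring
      _ ≤ _ := this
      _ = _ := by ring
  have hr : ‖ratFactor u μ v x‖ ≤ ∑ p, ‖v p‖ + ‖(μ : ℂ)‖ := by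
    refine (norm_add_le _ _).trans (add_le_add ((norm_sum_le _ _).trans
      (Finset.sum_le_sum fun p _ => ?_)) le_rfl)
    rw [norm_div]
    refine div_le_self (norm_nonneg _) ?_
    have h3 : |(x - u.z p).im| ≤ ‖x - u.z p‖ := abs_im_le_norm _
    rw [sub_im] at h3
    have := neg_abs_le (x.im - (u.z p).im)
    linarith [u.im_z_pos p]
  rw [norm_mul]
  calc _ ≤ (Real.exp (1 / ε) * Real.exp (lam / ε * x.im)) * (∑ p, ‖v p‖ + ‖(μ : ℂ)‖) := by gcongr
    _ = _ := by ring

theorem StartsAtNegI.exists_bound {ε lam μ : ℝ} {v : Fin P → ℂ} (hε : 0 < ε) (hlam : 0 < lam)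
    {γ : ℝ → ℂ} (h : StartsAtNegI u γ) : ∃ M η : ℝ, 0 < η ∧ ∀ᶠ t in atBot,
      ‖weight u ε lam (γ t) * ratFactor u μ v (γ t)‖ ≤ M * Real.exp (η * t) := by
  obtain ⟨M, T, hM, hb⟩ := exists_weight_bound (u := u) (lam := lam) (μ := μ) (v := v) hε
  have htend := h.tendsto
  obtain ⟨δ, hδ, T', hT'⟩ := h
  refine ⟨M, lam / ε * δ, by positivity, ?_⟩
  filter_upwards [eventually_le_atBot T', (tendsto_comap_iff.1 (htend.mono_right inf_le_left)).eventually (eventually_le_atBot T)] with t h1 h2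
  refine (hb _ (hT' t h1).1 h2).trans ?_
  refine mul_le_mul_of_nonneg_left (Real.exp_le_exp.2 ?_) hM
  rw [mul_assoc]
  exact mul_le_mul_of_nonneg_left (hT' t h1).2 (by positivity)

theorem convex_G₀ : Convex ℝ u.G₀ := by
  have : u.G₀ = ⋂ p, {x : ℂ | x.re < (u.z p).re} := by ext; simp [RationalPotential.G₀]
  rw [this]
  exact convex_iInter fun p => convex_halfSpace_re_lt _

theorem tendsto_linear_mul_exp_atBot {η : ℝ} (hη : 0 < η) (a b : ℝ) :
    Tendsto (fun t : ℝ => Real.exp (η * t) * (a + b * |t|)) atBot (𝓝 0) := by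
  have h1 : Tendsto (fun s : ℝ => Real.exp (-(η * s))) atTop (𝓝 0) :=
    Real.tendsto_exp_neg_atTop_nhds_zero.comp ((tendsto_const_mul_atTop_of_pos hη).2 tendsto_id)
  have h2 : Tendsto (fun s : ℝ => (η * s) ^ 1 * Real.exp (-(η * s))) atTop (𝓝 0) :=
    (Real.tendsto_pow_mul_exp_neg_atTop_nhds_zero 1).comp
      ((tendsto_const_mul_atTop_of_pos hη).2 tendsto_id)
  have h3 := ((h1.mul_const a).add (h2.const_mul (b / η))).comp tendsto_neg_atBot_atTop
  simp only [zero_mul, mul_zero, add_zero] at h3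
  refine h3.congr' ?_
  filter_upwards [eventually_le_atBot 0] with t ht
  simp only [Function.comp, abs_of_nonpos ht, pow_one, mul_neg, neg_neg]
  field_simp

/-- The limit at `-i∞` does not depend on the contour. At time `t` both points lie in the convex set
`G₀ ∩ {Im ≤ δt}`, where the derivative of `Φ` is exponentially small, while their distance grows at
most linearly by the Lipschitz bounds. -/
theorem tendsto_sub_of_startsAtNegI {ε lam μ : ℝ} {v : Fin P → ℂ} (hε : 0 < ε) (hlam : 0 < lam)
    {Φ : ℂ → ℂ} (h : ∀ x ∈ u.G, HasDerivAt Φ (weight u ε lam x * ratFactor u μ v x) x)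
    {γ₁ γ₂ : ℝ → ℂ} (hL₁ : ∃ K, LipschitzWith K γ₁) (hL₂ : ∃ K, LipschitzWith K γ₂)
    (h₁ : StartsAtNegI u γ₁) (h₂ : StartsAtNegI u γ₂) :
    Tendsto (fun t => Φ (γ₁ t) - Φ (γ₂ t)) atBot (𝓝 0) := by
  obtain ⟨M, T, hM, hb⟩ := exists_weight_bound (u := u) (lam := lam) (μ := μ) (v := v) hε
  obtain ⟨δ₁, hδ₁, T₁, hT₁⟩ := h₁
  obtain ⟨δ₂, hδ₂, T₂, hT₂⟩ := h₂
  obtain ⟨K₁, hK₁⟩ := hL₁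
  obtain ⟨K₂, hK₂⟩ := hL₂
  set δ := min δ₁ δ₂ with hδ
  have hδ0 : 0 < δ := lt_min hδ₁ hδ₂
  have hη : 0 < lam / ε * δ := by positivity
  have hlim := (tendsto_linear_mul_exp_atBot hη (‖γ₁ 0 - γ₂ 0‖) (K₁ + K₂)).const_mul M
  rw [mul_zero] at hlim
  refine squeeze_zero_norm' ?_ hlim
  filter_upwards [eventually_le_atBot T₁, eventually_le_atBot T₂, eventually_le_atBot 0,
    eventually_le_atBot (T / δ)] with t t1 t2 t0 t3
  have hδt : δ * t ≤ T := by rwa [le_div_iff₀' hδ0] at t3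
  have hconv : Convex ℝ (u.G₀ ∩ {x | x.im ≤ δ * t}) := convex_G₀.inter (convex_halfSpace_im_le _)
  have hbd : ∀ x ∈ u.G₀ ∩ {x | x.im ≤ δ * t},
      ‖weight u ε lam x * ratFactor u μ v x‖ ≤ M * Real.exp (lam / ε * δ * t) := by
    rintro x ⟨hx, hx'⟩
    refine (hb x hx (le_trans hx' hδt)).trans ?_
    refine mul_le_mul_of_nonneg_left (Real.exp_le_exp.2 ?_) hM
    rw [mul_assoc]
    exact mul_le_mul_of_nonneg_left hx' (by positivity)
  have hm : ∀ {δ' : ℝ} {y : ℂ}, δ ≤ δ' → y.im ≤ δ' * t → y.im ≤ δ * t := fun h1 h2 =>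
    h2.trans (mul_le_mul_of_nonpos_right h1 t0)
  have := hconv.norm_image_sub_le_of_norm_hasDerivWithin_le
    (fun x hx => (h x (u.mem_G_of_mem_G₀ hx.1)).hasDerivWithinAt) hbd
    ⟨(hT₂ t t2).1, hm (min_le_right _ _) (hT₂ t t2).2⟩
    ⟨(hT₁ t t1).1, hm (min_le_left _ _) (hT₁ t t1).2⟩
  refine this.trans ?_
  rw [mul_assoc]
  gcongr
  have e1 := hK₁.dist_le_mul t 0
  have e2 := hK₂.dist_le_mul t 0
  rw [dist_eq_norm, Real.dist_eq, sub_zero] at e1 e2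
  calc ‖γ₁ t - γ₂ t‖ = ‖(γ₁ 0 - γ₂ 0) + ((γ₁ t - γ₁ 0) - (γ₂ t - γ₂ 0))‖ := by congr 1; ring
    _ ≤ ‖γ₁ 0 - γ₂ 0‖ + (‖γ₁ t - γ₁ 0‖ + ‖γ₂ t - γ₂ 0‖) :=
      (norm_add_le _ _).trans (add_le_add le_rfl (norm_sub_le _ _))
    _ ≤ ‖γ₁ 0 - γ₂ 0‖ + (K₁ + K₂) * |t| := by linarith

end BenjaminOno

/-! ### Convergence and evaluation of the contour integrals -/

namespace BenjaminOno

open Complex Set Filter Topology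

variable {P : ℕ} {u : RationalPotential P}

theorem mul_mul_deriv_integrableOn {φ γ : ℝ → ℂ} {s : Set ℝ} (hφ : MeasureTheory.IntegrableOn φ s)
    (hγ : IsRegularPath γ) : MeasureTheory.IntegrableOn (fun t => φ t * deriv γ t) s := by
  obtain ⟨K, hK⟩ := hγ.1
  exact MeasureTheory.Integrable.mul_bdd (c := (K : ℝ)) hφ (aestronglyMeasurable_deriv γ _)
    (Eventually.of_forall fun t => norm_deriv_le_of_lipschitz hK)

theorem IsRegularPath.continuous {γ : ℝ → ℂ} (hγ : IsRegularPath γ) : Continuous γ := by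
  obtain ⟨K, hK⟩ := hγ.1
  exact hK.continuous

theorem continuousAt_weight_mul_ratFactor {ε lam μ : ℝ} {v : Fin P → ℂ} {x : ℂ} (hx : x ∈ u.G) :
    ContinuousAt (fun x => weight u ε lam x * ratFactor u μ v x) x :=
  (hasDerivAt_weight hx).continuousAt.mul
    (differentiableAt_ratFactor (u.ne_z_of_mem_G hx)).continuousAt

/-! ### Loops -/

theorem Crosses.ne_z {γ : ℝ → ℂ} {s : Finset (Fin P)} {τ : Fin P → ℝ} (hc : Crosses u γ s τ)
    (t : ℝ) (p : Fin P) : γ t ≠ u.z p := by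
  by_cases ht : ∀ j ∈ s, t ≠ τ j
  · exact u.ne_z_of_mem_G (hc.mem_G t ht) p
  · push Not at ht
    obtain ⟨j, hj, rfl⟩ := ht
    exact u.ne_z_of_mem_aboveStrip (u.upperCut_subset_aboveStrip j (hc.mem_cut j hj)) p

theorem Crosses.finite_times {γ : ℝ → ℂ} {s : Finset (Fin P)} {τ : Fin P → ℝ}
    (_ : Crosses u γ s τ) : (τ '' s).Finite := s.finite_toSet.image τ

/-- Both sides are continuous, have the same derivative off a finite set, and tend to `0` at the
start of the loop. -/
theorem IsLoop.fval_eq {m : Fin P} {C : LiftedContour} (hC : IsLoop u m C) {τ : Fin P → ℝ}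
    (hc : Crosses u C.path (Finset.Iic m) τ) (t : ℝ) :
    C.fval t = u.f (C.path t) + ∑ p ∈ crossed (Finset.Iic m) τ t, 2 * Real.pi * I * u.c p := by
  have hcont := hc.continuous_continuation hC.regular.continuous u.hasJumps_f
  obtain ⟨S, hS, hSd⟩ := hC.regular.2
  obtain ⟨S', hS', hSd'⟩ := hC.fval_deriv
  set Y : ℝ → ℂ := fun t => (∏ p ∈ crossed (Finset.Iic m) τ t, (1 : Fin P → ℂ) p) *
    u.f (C.path t) + acquired 1 (fun p => 2 * Real.pi * I * u.c p) (Finset.Iic m) τ t with hY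
  have hYeq : ∀ t, Y t = u.f (C.path t) +
      ∑ p ∈ crossed (Finset.Iic m) τ t, 2 * Real.pi * I * u.c p := by
    intro t
    simp [hY, acquired]
  have hconst : ∀ a b, C.fval a - Y a = C.fval b - Y b := by
    refine const_of_hasDerivAt_zero_off_finite (D := fun t => C.fval t - Y t)
      (hC.fval_continuous.sub hcont) ((hS.union hS').union hc.finite_times) fun t ht => ?_
    simp only [mem_union, not_or] at ht
    have h1 := hc.hasDerivAt_continuation u.hasJumps_f (t := t)
      (fun p hp h => ht.2 ⟨p, hp, h.symm⟩) (hSd t ht.1.1)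
    refine ((hSd' t ht.1.2).sub h1).congr_deriv ?_
    simp
  have hlim : Tendsto (fun t => C.fval t - Y t) atBot (𝓝 (0 - 0)) := by
    refine hC.fval_start.sub ((u.tendsto_f_negI.comp hC.start.tendsto).congr' ?_)
    filter_upwards [eventually_crossed_eq_empty (Finset.Iic m) τ] with t ht
    rw [hYeq, ht, Finset.sum_empty, add_zero]
    rfl
  have h0 : C.fval t - Y t = 0 - 0 :=
    tendsto_nhds_unique (tendsto_const_nhds.congr fun s => hconst t s) hlim
  rw [← hYeq]
  exact sub_eq_zero.1 (by rw [h0, sub_zero])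

theorem IsLoop.exp_eq {m : Fin P} {C : LiftedContour} (hC : IsLoop u m C) {τ : Fin P → ℝ}
    (hc : Crosses u C.path (Finset.Iic m) τ) (ε lam : ℝ) (t : ℝ) :
    Complex.exp (-I * (lam * C.path t + C.fval t) / ε) =
      (∏ p ∈ crossed (Finset.Iic m) τ t, monodromy u ε p) * weight u ε lam (C.path t) := by
  simp only [monodromy, weight]
  rw [hC.fval_eq hc, ← Complex.exp_sum, ← Complex.exp_add, ← Finset.sum_div]
  simp only [← Finset.mul_sum]
  congr 1
  ring

theorem IsLoop.integrable {ε lam μ : ℝ} {v : Fin P → ℂ} (hε : 0 < ε) (hlam : 0 < lam) {m : Fin P}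
    {C : LiftedContour} (hC : IsLoop u m C) :
    MeasureTheory.Integrable (pullback ε lam C (ratFactor u μ v)) := by
  obtain ⟨τ, hc⟩ := hC.exists_crosses
  rw [← MeasureTheory.integrableOn_univ]
  refine mul_mul_deriv_integrableOn (MeasureTheory.integrableOn_univ.2 ?_) hC.regular
  have hcont : Continuous fun t => Complex.exp (-I * (lam * C.path t + C.fval t) / ε) *
      ratFactor u μ v (C.path t) := by
    have h1 := hC.regular.continuous
    have h2 := hC.fval_continuous
    refine Continuous.mul (by fun_prop) (continuous_iff_continuousAt.2 fun t => ?_)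
    exact (differentiableAt_ratFactor (hc.ne_z t)).continuousAt.comp h1.continuousAt
  obtain ⟨M₁, η₁, h1, hb1⟩ := hC.start.exists_bound (μ := μ) (v := v) hε hlam
  obtain ⟨M₂, η₂, h2, hb2⟩ := hC.finish.starts.exists_bound (μ := μ) (v := v) hε hlam
  refine integrable_of_exp_bounds hcont h1 h2 (M₁ := M₁)
    -- On the way back all cuts up to `m` have been crossed, so the weight carries the full product
    -- of monodromies.
    (M₂ := ‖∏ p ∈ Finset.Iic m, monodromy u ε p‖ * M₂) ?_ ?_
  · filter_upwards [hb1, eventually_crossed_eq_empty (Finset.Iic m) τ] with t ht h0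
    rwa [hC.exp_eq hc, h0, Finset.prod_empty, one_mul]
  · filter_upwards [tendsto_neg_atTop_atBot.eventually hb2,
      eventually_crossed_eq_self (Finset.Iic m) τ] with t ht h0
    rw [hC.exp_eq hc, h0, mul_assoc, norm_mul, mul_assoc]
    gcongr
    simpa using ht

/-- The integral over a loop in terms of the jumps of a primitive that vanishes at `-i∞`. -/
theorem IsLoop.contourIntegral_eq {ε lam μ : ℝ} {v : Fin P → ℂ} (hε : 0 < ε) (hlam : 0 < lam)
    {m : Fin P} {C : LiftedContour} (hC : IsLoop u m C) {τ : Fin P → ℝ}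
    (hc : Crosses u C.path (Finset.Iic m) τ) {Φ : ℂ → ℂ} {κ : Fin P → ℂ}
    (hΦ : HasJumps u Φ (fun x => weight u ε lam x * ratFactor u μ v x) (monodromy u ε) κ)
    (h0 : ∀ γ : ℝ → ℂ, (∃ K, LipschitzWith K γ) → StartsAtNegI u γ →
      Tendsto (fun t => Φ (γ t)) atBot (𝓝 0)) :
    contourIntegral ε lam C (ratFactor u μ v) =
      ∑ p ∈ Finset.Iic m, (∏ j ∈ crossed (Finset.Iic m) τ (τ p), monodromy u ε j) * κ p := by
  have hcont := hc.continuous_continuation hC.regular.continuous hΦ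
  obtain ⟨S, hS, hSd⟩ := hC.regular.2
  have hlimBot : Tendsto (fun t => (∏ p ∈ crossed (Finset.Iic m) τ t, monodromy u ε p) *
      Φ (C.path t) + acquired (monodromy u ε) κ (Finset.Iic m) τ t) atBot (𝓝 0) := by
    refine (h0 _ hC.regular.1 hC.start).congr' ?_
    filter_upwards [eventually_crossed_eq_empty (Finset.Iic m) τ] with t ht
    simp [acquired, ht]
  have hlimTop : Tendsto (fun t => (∏ p ∈ crossed (Finset.Iic m) τ t, monodromy u ε p) *
      Φ (C.path t) + acquired (monodromy u ε) κ (Finset.Iic m) τ t) atTop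
      (𝓝 ((∏ p ∈ Finset.Iic m, monodromy u ε p) * 0 + ∑ p ∈ Finset.Iic m,
        (∏ j ∈ crossed (Finset.Iic m) τ (τ p), monodromy u ε j) * κ p)) := by
    have hL : ∃ K, LipschitzWith K fun t => C.path (-t) := by
      obtain ⟨K, hK⟩ := hC.regular.1
      exact ⟨K * 1, hK.comp LipschitzWith.id.neg⟩
    have h1 := (h0 _ hL hC.finish.starts).comp tendsto_neg_atTop_atBot
    simp only [Function.comp_def, neg_neg] at h1
    refine ((h1.const_mul _).add_const _).congr' ?_
    filter_upwards [eventually_crossed_eq_self (Finset.Iic m) τ] with t ht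
    simp [acquired, ht]
  have := integral_eq_sub_of_hasDerivAt_off_finite hcont (hS.union hc.finite_times)
    (y := pullback ε lam C (ratFactor u μ v)) (fun t ht => ?_) (hC.integrable hε hlam) hlimBot hlimTop
  · rw [contourIntegral, this]
    ring
  · simp only [mem_union, not_or] at ht
    refine (hc.hasDerivAt_continuation hΦ (fun p hp h => ht.2 ⟨p, hp, h.symm⟩)
      (hSd t ht.1)).congr_deriv ?_
    rw [pullback, hC.exp_eq hc]
    ring

/-! ### Contours with an end point -/

theorem IsEllZero.deriv_eq_zero {x : ℂ} {C : LiftedContour} (hC : IsEllZero u x C) {t : ℝ}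
    (ht : 0 < t) : deriv C.path t = 0 := by
  have : C.path =ᶠ[𝓝 t] fun _ => x := by
    filter_upwards [lt_mem_nhds ht] with s hs using hC.arrives s hs.le
  rw [this.deriv_eq, deriv_const]

theorem IsEllZero.tendsto_nhdsLT {x : ℂ} {C : LiftedContour} (hC : IsEllZero u x C) :
    Tendsto C.path (𝓝[<] 0) (𝓝[u.G] x) := by
  refine tendsto_nhdsWithin_iff.2 ⟨?_, ?_⟩
  · have := hC.regular.continuous.tendsto 0
    rw [hC.arrives 0 le_rfl] at this
    exact this.mono_left nhdsWithin_le_nhds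
  · filter_upwards [self_mem_nhdsWithin] with t ht using hC.mem_G t ht

theorem IsEllZero.pullback_eq {x : ℂ} {C : LiftedContour} (hC : IsEllZero u x C) (ε lam : ℝ)
    (g : ℂ → ℂ) (t : ℝ) : pullback ε lam C g t =
      (weight u ε lam (C.path t) * g (C.path t)) * deriv C.path t := by
  rw [pullback, hC.fval_eq]
  rfl

/-- Only boundedness within `G` is asked at the end point, so that points of `G` and exceptional
poles are covered alike. -/
theorem IsEllZero.integrable {ε lam μ : ℝ} {v : Fin P → ℂ} (hε : 0 < ε) (hlam : 0 < lam) {x : ℂ}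
    {C : LiftedContour} (hC : IsEllZero u x C)
    (hx : ∃ M, ∀ᶠ y in 𝓝[u.G] x, ‖weight u ε lam y * ratFactor u μ v y‖ ≤ M) :
    MeasureTheory.Integrable (pullback ε lam C (ratFactor u μ v)) := by
  obtain ⟨M₂, hM₂⟩ := hx
  obtain ⟨M₁, η, hη, hb⟩ := hC.start.exists_bound (μ := μ) (v := v) hε hlam
  have hcont : ContinuousOn (fun t => weight u ε lam (C.path t) * ratFactor u μ v (C.path t))
      (Iio 0) := fun t ht => ((continuousAt_weight_mul_ratFactor (hC.mem_G t ht)).comp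
        hC.regular.continuous.continuousAt).continuousWithinAt
  have h1 := mul_mul_deriv_integrableOn (integrableOn_Iio_zero_of_exp_bound hcont hη hb
    (hC.tendsto_nhdsLT.eventually hM₂)) hC.regular
  refine (h1.integrable_indicator measurableSet_Iio).congr ?_
  have h0 : ∀ᵐ t : ℝ, t ≠ 0 := by simp [MeasureTheory.ae_iff]
  filter_upwards [h0] with t ht
  rw [hC.pullback_eq]
  rcases ht.lt_or_gt with h | h
  · rw [indicator_of_mem (by exact h)]
  · rw [indicator_of_notMem (by simpa using h.le), hC.deriv_eq_zero h, mul_zero]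

theorem IsEllZero.integrable_of_mem {ε lam μ : ℝ} {v : Fin P → ℂ} (hε : 0 < ε) (hlam : 0 < lam)
    {x : ℂ} {C : LiftedContour} (hC : IsEllZero u x C) (hx : x ∈ u.G) :
    MeasureTheory.Integrable (pullback ε lam C (ratFactor u μ v)) := by
  refine hC.integrable hε hlam ⟨‖weight u ε lam x * ratFactor u μ v x‖ + 1, ?_⟩
  refine (Filter.Eventually.mono ?_ fun t ht => le_of_lt ht).filter_mono nhdsWithin_le_nhds
  exact (continuousAt_weight_mul_ratFactor hx).norm.eventually_lt continuousAt_const (lt_add_one _)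

theorem IsEllZero.contourIntegral_eq {ε lam μ : ℝ} {v : Fin P → ℂ} {x : ℂ} {C : LiftedContour}
    (hC : IsEllZero u x C)
    (hint : MeasureTheory.Integrable (pullback ε lam C (ratFactor u μ v))) {Φ : ℂ → ℂ}
    (hΦ : ∀ x ∈ u.G, HasDerivAt Φ (weight u ε lam x * ratFactor u μ v x) x)
    (h0 : ∀ γ : ℝ → ℂ, (∃ K, LipschitzWith K γ) → StartsAtNegI u γ →
      Tendsto (fun t => Φ (γ t)) atBot (𝓝 0)) {L : ℂ} (hL : Tendsto Φ (𝓝[u.G] x) (𝓝 L)) :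
    contourIntegral ε lam C (ratFactor u μ v) = L := by
  obtain ⟨S, hS, hSd⟩ := hC.regular.2
  -- The value of `Φ` at the end point is replaced by its limit from `G`, since `x` may be a pole,
  -- where `Φ x` has no meaning.
  set Y : ℝ → ℂ := fun t => if t < 0 then Φ (C.path t) else L with hY
  have hneg : ∀ t < 0, Y =ᶠ[𝓝 t] fun s => Φ (C.path s) := fun t ht => by
    filter_upwards [gt_mem_nhds ht] with s hs using if_pos hs
  have hpos : ∀ t > 0, Y =ᶠ[𝓝 t] fun _ => L := fun t ht => by
    filter_upwards [lt_mem_nhds ht] with s hs using if_neg hs.not_gt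
  have hcont : Continuous Y := by
    refine continuous_iff_continuousAt.2 fun t => ?_
    rcases lt_trichotomy t 0 with h | rfl | h
    · refine ContinuousAt.congr ?_ (hneg t h).symm
      exact (hΦ _ (hC.mem_G t h)).continuousAt.comp hC.regular.continuous.continuousAt
    · rw [ContinuousAt, ← nhdsLT_sup_nhdsGE]
      have hY0 : Y 0 = L := if_neg (lt_irrefl _)
      rw [hY0]
      refine Tendsto.sup ((hL.comp hC.tendsto_nhdsLT).congr' ?_) (tendsto_const_nhds.congr' ?_)
      · filter_upwards [self_mem_nhdsWithin] with s hs using (if_pos hs).symm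
      · filter_upwards [self_mem_nhdsWithin] with s hs
        exact (if_neg (not_lt.2 hs)).symm
    · exact continuousAt_const.congr (hpos t h).symm
  have := integral_eq_sub_of_hasDerivAt_off_finite hcont (hS.union (finite_singleton (0 : ℝ)))
    (y := pullback ε lam C (ratFactor u μ v)) (l := 0) (r := L) (fun t ht => ?_) hint ?_ ?_
  · rw [contourIntegral, this, sub_zero]
  · simp only [mem_union, mem_singleton_iff, not_or] at ht
    rw [hC.pullback_eq]
    rcases lt_or_gt_of_ne ht.2 with h | h
    · exact ((hΦ _ (hC.mem_G t h)).comp t (hSd t ht.1).hasDerivAt).congr_of_eventuallyEq (hneg t h)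
    · rw [hC.deriv_eq_zero h, mul_zero]
      exact (hasDerivAt_const t L).congr_of_eventuallyEq (hpos t h)
  · refine (h0 _ hC.regular.1 hC.start).congr' ?_
    filter_upwards [eventually_lt_atBot 0] with t ht using (if_pos ht).symm
  · refine tendsto_const_nhds.congr' ?_
    filter_upwards [eventually_gt_atTop 0] with t ht using (if_neg ht.not_gt).symm

/-- There is a primitive of `weight * ratFactor` that vanishes at `-i∞`, and it has jumps across
the upper cuts. -/
theorem exists_normalized_primitive {ε lam μ : ℝ} {v : Fin P → ℂ} (hε : 0 < ε) (hlam : 0 < lam)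
    {x : ℂ} {C : LiftedContour} (hC : IsEllZero u x C) (hx : x ∈ u.G) :
    ∃ Φ κ, HasJumps u Φ (fun x => weight u ε lam x * ratFactor u μ v x) (monodromy u ε) κ ∧
      ∀ γ : ℝ → ℂ, (∃ K, LipschitzWith K γ) → StartsAtNegI u γ →
        Tendsto (fun t => Φ (γ t)) atBot (𝓝 0) := by
  obtain ⟨Ψ, hΨ⟩ := u.exists_primitive_G (g := fun x => weight u ε lam x * ratFactor u μ v x)
    fun y hy => ((hasDerivAt_weight hy).differentiableAt.mul
      (differentiableAt_ratFactor (u.ne_z_of_mem_G hy))).differentiableWithinAt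
  have hmem : ∀ t, C.path t ∈ u.G := by
    intro t
    rcases lt_or_ge t 0 with h | h
    · exact hC.mem_G t h
    · rwa [hC.arrives t h]
  obtain ⟨S, hS, hSd⟩ := hC.regular.2
  -- One convergent integral shows that a primitive has a limit at `-i∞`; path independence then
  -- makes `Ψ - l` vanish along every other contour.
  obtain ⟨l, hl⟩ := exists_tendsto_atBot_of_hasDerivAt_off_finite
    (Y := fun t => Ψ (C.path t)) (y := pullback ε lam C (ratFactor u μ v))
    (continuous_iff_continuousAt.2 fun t =>
      (hΨ _ (hmem t)).continuousAt.comp hC.regular.continuous.continuousAt) hS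
    (fun t ht => by
      rw [hC.pullback_eq]
      exact (hΨ _ (hmem t)).comp t (hSd t ht).hasDerivAt)
    (hC.integrable_of_mem hε hlam hx)
  obtain ⟨Φ, κ, hΦ, hJ⟩ := exists_hasJumps (Φ₀ := fun y => Ψ y - l) fun y hy =>
    (hΨ y hy).sub_const l
  refine ⟨Φ, κ, hJ, fun γ hγ hs => ?_⟩
  have h1 := (tendsto_sub_of_startsAtNegI hε hlam hΨ hγ hC.regular.1 hs hC.start).add
    (hl.sub_const l)
  rw [sub_self, add_zero] at h1
  refine h1.congr' ?_
  obtain ⟨δ, -, T, hT⟩ := hs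
  filter_upwards [eventually_le_atBot T] with t ht
  rw [hΦ (u.mem_G_of_mem_G₀ (hT t ht).1)]
  ring

end BenjaminOno

/-! ### The differential equation for `W_+` and its continuation across the cuts -/

namespace BenjaminOno

open Complex Set Filter Topology

variable {P : ℕ} {u : RationalPotential P}

/-- `-(i/ε) e^{ih/ε} Φ`, which is `W_+` when `Φ` is the normalised primitive. -/
noncomputable def wave (u : RationalPotential P) (ε lam : ℝ) (Φ : ℂ → ℂ) (x : ℂ) : ℂ :=
  -(I / ε) * Complex.exp (I * (lam * x + u.f x) / ε) * Φ x

/-- Stated for an arbitrary branch `F` of the potential, to apply also to the branch continued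
across a cut. -/
theorem hasDerivAt_wave_aux {ε lam : ℝ} {F Φ : ℂ → ℂ} {F' r x : ℂ} (hF : HasDerivAt F F' x)
    (hΦ : HasDerivAt Φ (Complex.exp (-I * (lam * x + F x) / ε) * r) x) :
    HasDerivAt (fun y => -(I / ε) * Complex.exp (I * (lam * y + F y) / ε) * Φ y)
      (I / ε * ((lam + F') * (-(I / ε) * Complex.exp (I * (lam * x + F x) / ε) * Φ x) - r)) x := by
  have h1 : HasDerivAt (fun y => I * (lam * y + F y) / ε) (I * (lam * 1 + F') / ε) x :=
    ((((hasDerivAt_id x).const_mul (lam : ℂ)).add hF).const_mul I).div_const _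
  refine ((h1.cexp.const_mul (-(I / ε))).mul hΦ).congr_deriv ?_
  have h2 : Complex.exp (I * (lam * x + F x) / ε) * Complex.exp (-I * (lam * x + F x) / ε) = 1 := by
    rw [← Complex.exp_add, ← Complex.exp_zero]
    congr 1
    ring
  linear_combination (-(I / ε) * r) * h2

theorem hasDerivAt_wave_of_mem_G {ε lam μ : ℝ} {v : Fin P → ℂ} {Φ : ℂ → ℂ} {x : ℂ} (hx : x ∈ u.G)
    (hΦ : HasDerivAt Φ (weight u ε lam x * ratFactor u μ v x) x) :
    HasDerivAt (wave u ε lam Φ)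
      (I / ε * ((lam + u.u₀ x) * wave u ε lam Φ x - ratFactor u μ v x)) x :=
  hasDerivAt_wave_aux (u.hasDerivAt_f hx) hΦ

/-- Near the upper cut of `z_p`, the continuation of `wave` from the right differs on the left by a
nonvanishing multiple of the jump `κ p`. -/
theorem HasJumps.exists_wave_right {ε lam μ : ℝ} {v : Fin P → ℂ} {Φ : ℂ → ℂ} {κ : Fin P → ℂ}
    (hε : 0 < ε)
    (hΦ : HasJumps u Φ (fun x => weight u ε lam x * ratFactor u μ v x) (monodromy u ε) κ)
    (p : Fin P) : ∃ W E : ℂ → ℂ, ∀ x ∈ u.aboveStrip p, DifferentiableAt ℂ W x ∧ ContinuousAt E x ∧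
      E x ≠ 0 ∧
      (x.re = (u.z p).re → HasDerivAt W
        (I / ε * ((lam + u.u₀ x) * wave u ε lam Φ x - ratFactor u μ v x)) x) ∧
      ((u.z p).re ≤ x.re → W x = wave u ε lam Φ x) ∧
      (x.re < (u.z p).re → W x = wave u ε lam Φ x + E x * κ p) := by
  obtain ⟨f, f', hf⟩ := u.hasJumps_f.jump p
  obtain ⟨R, R', hR⟩ := hΦ.jump p
  have hW : ∀ x ∈ u.aboveStrip p, (u.z p).re ≤ x.re →
      -(I / ε) * Complex.exp (I * (lam * x + f x) / ε) * R x = wave u ε lam Φ x := by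
    intro x hx hre
    rw [wave, ((hf x hx).2.1 hre).1, ((hR x hx).2.1 hre).1]
  have hε' : (ε : ℂ) ≠ 0 := by exact_mod_cast hε.ne'
  have hEc : ∀ x ∈ u.aboveStrip p, DifferentiableAt ℂ
      (fun x => -(I / ε) * Complex.exp (I * (lam * x + f x) / ε)) x := by
    intro x hx
    have := (hf x hx).1.differentiableAt
    fun_prop
  refine ⟨fun x => -(I / ε) * Complex.exp (I * (lam * x + f x) / ε) * R x,
    fun x => -(I / ε) * Complex.exp (I * (lam * x + f x) / ε), fun x hx => ⟨?_, ?_, ?_, ?_, ?_, ?_⟩⟩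
  · exact (hEc x hx).mul (hR x hx).1.differentiableAt
  · exact (hEc x hx).continuousAt
  · exact mul_ne_zero (neg_ne_zero.2 (div_ne_zero I_ne_zero hε')) (Complex.exp_ne_zero _)
  · intro hre
    rw [← hW x hx hre.ge]
    obtain ⟨e1, e2⟩ := (hf x hx).2.1 hre.ge
    rw [← e2]
    refine hasDerivAt_wave_aux (hf x hx).1 ((hR x hx).1.congr_deriv ?_)
    rw [((hR x hx).2.1 hre.ge).2, e1]
    rfl
  · exact hW x hx
  · intro hre
    simp only
    rw [(hR x hx).2.2 hre, mul_add, wave, (hf x hx).2.2 hre]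
    congr 1
    -- The monodromy of `Φ` cancels the inverse factor from `e^{ih/ε}`, leaving only the term with
    -- `κ p`.
    rw [← mul_assoc, mul_assoc (-(I / (ε : ℂ))), monodromy, ← Complex.exp_add]
    congr 3
    simp only [Pi.one_apply]
    ring

/-- In the absence of jumps, `wave` solves the differential equation in the whole upper half-plane
apart from the poles. -/
theorem HasJumps.hasDerivAt_wave {ε lam μ : ℝ} {v : Fin P → ℂ} {Φ : ℂ → ℂ} {κ : Fin P → ℂ}
    (hε : 0 < ε)
    (hΦ : HasJumps u Φ (fun x => weight u ε lam x * ratFactor u μ v x) (monodromy u ε) κ)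
    (hκ : ∀ p, κ p = 0) {x : ℂ} (hx : 0 < x.im) (hz : ∀ p, x ≠ u.z p) :
    HasDerivAt (wave u ε lam Φ)
      (I / ε * ((lam + u.u₀ x) * wave u ε lam Φ x - ratFactor u μ v x)) x := by
  rcases u.mem_G_or_mem_upperCut hx hz with hG | ⟨p, hp⟩
  · exact hasDerivAt_wave_of_mem_G hG (hΦ.hasDerivAt x hG)
  · obtain ⟨W, E, hW⟩ := hΦ.exists_wave_right hε p
    have hxs := u.upperCut_subset_aboveStrip p hp
    refine ((hW x hxs).2.2.2.1 hp.1).congr_of_eventuallyEq ?_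
    filter_upwards [(u.isOpen_aboveStrip p).mem_nhds hxs] with y hy
    obtain ⟨-, -, -, -, h1, h2⟩ := hW y hy
    rcases le_or_gt (u.z p).re y.re with h | h
    · exact (h1 h).symm
    · rw [h2 h, hκ, mul_zero, add_zero]

theorem tendsto_add_ofReal_right (x : ℂ) :
    Tendsto (fun t : ℝ => x + t) (𝓝[>] 0) (𝓝 x) := by
  have : Tendsto (fun t : ℝ => x + t) (𝓝 0) (𝓝 (x + (0 : ℝ))) :=
    (Continuous.tendsto (by fun_prop) 0)
  rw [ofReal_zero, add_zero] at this
  exact this.mono_left nhdsWithin_le_nhds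

theorem tendsto_sub_ofReal_left (x : ℂ) :
    Tendsto (fun t : ℝ => x - t) (𝓝[>] 0) (𝓝 x) := by
  have : Tendsto (fun t : ℝ => x - t) (𝓝 0) (𝓝 (x - (0 : ℝ))) :=
    (Continuous.tendsto (by fun_prop) 0)
  rw [ofReal_zero, sub_zero] at this
  exact this.mono_left nhdsWithin_le_nhds

/-- A continuous extension across the upper cuts excludes jumps. -/
theorem HasJumps.eq_zero_of_extension {ε lam μ : ℝ} {v : Fin P → ℂ} {Φ : ℂ → ℂ} {κ : Fin P → ℂ}
    (hε : 0 < ε)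
    (hΦ : HasJumps u Φ (fun x => weight u ε lam x * ratFactor u μ v x) (monodromy u ε) κ)
    {F : ℂ → ℂ} (hF : ∀ x, 0 < x.im → ContinuousAt F x)
    (hFW : ∀ x ∈ u.G, 0 < x.im → F x = wave u ε lam Φ x) (p : Fin P) : κ p = 0 := by
  obtain ⟨W, E, hW⟩ := hΦ.exists_wave_right hε p
  -- A single test point on the cut suffices, as `κ p` is constant along it. Horizontal limits from
  -- the right and from the left give `F = W` and `F + E κ = W`.
  have hcut : u.z p + I ∈ u.upperCut p := by
    constructor
    · simp
    · simp
  set x := u.z p + I with hx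
  have hxs := u.upperCut_subset_aboveStrip p hcut
  have hpos := u.im_pos_of_mem_aboveStrip hxs
  have hnhds := (u.isOpen_aboveStrip p).mem_nhds hxs
  obtain ⟨hWd, hE, hE0, -, -, -⟩ := hW x hxs
  have h1 : F x = W x := by
    refine tendsto_nhds_unique ((hF x hpos).tendsto.comp (tendsto_add_ofReal_right x))
      ((hWd.continuousAt.tendsto.comp (tendsto_add_ofReal_right x)).congr' ?_)
    filter_upwards [(tendsto_add_ofReal_right x).eventually hnhds, self_mem_nhdsWithin] with t ht h0
    have hre : (u.z p).re < (x + t).re := by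
      have : (0 : ℝ) < t := h0
      simp [hx, this]
    simp only [Function.comp]
    rw [(hW _ ht).2.2.2.2.1 hre.le, hFW _ (u.mem_G_of_mem_aboveStrip ht hre.ne')
      (u.im_pos_of_mem_aboveStrip ht)]
  have h2 : F x + E x * κ p = W x := by
    refine tendsto_nhds_unique (((hF x hpos).add (hE.mul continuousAt_const)).tendsto.comp
      (tendsto_sub_ofReal_left x))
      ((hWd.continuousAt.tendsto.comp (tendsto_sub_ofReal_left x)).congr' ?_)
    filter_upwards [(tendsto_sub_ofReal_left x).eventually hnhds, self_mem_nhdsWithin] with t ht h0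
    have hre : (x - t).re < (u.z p).re := by
      have : (0 : ℝ) < t := h0
      simp [hx, this]
    simp only [Function.comp, Pi.add_apply, Pi.mul_apply]
    rw [(hW _ ht).2.2.2.2.2 hre, hFW _ (u.mem_G_of_mem_aboveStrip ht hre.ne)
      (u.im_pos_of_mem_aboveStrip ht)]
  rw [h1, add_eq_left] at h2
  exact (mul_eq_zero.1 h2).resolve_left hE0

/-! ### The poles -/

theorem exists_regular_part (a : Fin P → ℂ) (p : Fin P) : ∃ D : ℂ → ℂ, AnalyticAt ℂ D (u.z p) ∧
    ∀ x ≠ u.z p, (x - u.z p) * ∑ j, a j / (x - u.z j) = a p + (x - u.z p) * D x := by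
  refine ⟨fun x => ∑ j ∈ Finset.univ.erase p, a j / (x - u.z j), ?_, fun x hx => ?_⟩
  · refine Finset.analyticAt_fun_sum _ fun j hj => ?_
    refine analyticAt_const.div (by fun_prop) (sub_ne_zero.2 fun h => ?_)
    exact (Finset.ne_of_mem_erase hj) (u.re_z_strictMono.injective (congrArg re h).symm)
  · rw [← Finset.add_sum_erase _ _ (Finset.mem_univ p), mul_add, mul_div_cancel₀]
    exact sub_ne_zero.2 hx

theorem exists_regular_ratFactor (μ : ℝ) (v : Fin P → ℂ) (p : Fin P) : ∃ B : ℂ → ℂ,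
    AnalyticAt ℂ B (u.z p) ∧ B (u.z p) = v p ∧
    ∀ x ≠ u.z p, (x - u.z p) * ratFactor u μ v x = B x := by
  obtain ⟨D, hD, h⟩ := exists_regular_part (u := u) v p
  refine ⟨fun x => v p + (x - u.z p) * (D x + μ), by fun_prop, by simp, fun x hx => ?_⟩
  rw [ratFactor, mul_add, h x hx]
  ring

/-- The value `A(z_p) = c_p` makes `i c_p/ε` the exponent of the differential equation at `z_p`. -/
theorem exists_regular_u₀ (lam : ℝ) (p : Fin P) : ∃ A : ℂ → ℂ, AnalyticAt ℂ A (u.z p) ∧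
    A (u.z p) = u.c p ∧ ∀ x ≠ u.z p, (x - u.z p) * (lam + u.u₀ x) = A x := by
  obtain ⟨D, hD, h⟩ := exists_regular_part (u := u) u.c p
  have hc : AnalyticAt ℂ (fun x => ∑ j, (starRingEnd ℂ) (u.c j) / (x - (starRingEnd ℂ) (u.z j)))
      (u.z p) :=
    Finset.analyticAt_fun_sum _ fun j _ => analyticAt_const.div (by fun_prop)
      (sub_ne_zero.2 (u.ne_conj_z_of_im_pos (u.im_z_pos p) j))
  refine ⟨fun x => u.c p + (x - u.z p) * (D x + lam +
    ∑ j, (starRingEnd ℂ) (u.c j) / (x - (starRingEnd ℂ) (u.z j))), by fun_prop, by simp,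
    fun x hx => ?_⟩
  rw [RationalPotential.u₀, Finset.sum_add_distrib]
  linear_combination h x hx

theorem eventually_ne_z (p : Fin P) : ∀ᶠ x in 𝓝[≠] (u.z p), 0 < x.im ∧ ∀ j, x ≠ u.z j := by
  have h1 : ∀ᶠ x in 𝓝[≠] (u.z p), 0 < x.im :=
    (continuous_im.continuousAt.eventually_const_lt (u.im_z_pos p)).filter_mono nhdsWithin_le_nhds
  refine h1.and (eventually_all.2 fun j => ?_)
  by_cases hj : j = p
  · subst hj
    exact self_mem_nhdsWithin
  · refine (isOpen_compl_singleton.mem_nhds ?_ : {u.z j}ᶜ ∈ 𝓝 (u.z p)) |> mem_nhdsWithin_of_mem_nhds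
    exact fun h => hj (u.re_z_strictMono.injective (congrArg re h).symm)

/-- Away from the exceptional values of the exponent, `wave` extends analytically to `z_p` as soon
as it has no jumps. -/
theorem HasJumps.exists_analyticAt_wave {ε lam μ : ℝ} {v : Fin P → ℂ} {Φ : ℂ → ℂ} {κ : Fin P → ℂ}
    (hε : 0 < ε)
    (hΦ : HasJumps u Φ (fun x => weight u ε lam x * ratFactor u μ v x) (monodromy u ε) κ)
    (hκ : ∀ p, κ p = 0) {p : Fin P} (hp : ¬ ∃ n : ℕ, I * u.c p / ε = -((n : ℂ) + 1)) :
    ∃ ω : ℂ → ℂ, AnalyticAt ℂ ω (u.z p) ∧ ∀ᶠ x in 𝓝[≠] (u.z p), wave u ε lam Φ x = ω x := by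
  obtain ⟨A, hA, hA0, hA1⟩ := exists_regular_u₀ (u := u) lam p
  obtain ⟨B, hB, -, hB1⟩ := exists_regular_ratFactor (u := u) μ v p
  refine exists_analyticAt_of_regular_singular (A := fun x => I / ε * A x)
    (B := fun x => -(I / ε) * B x) (continuousAt_const.mul hA.continuousAt)
    (continuousAt_const.mul hB.continuousAt) ?_ fun n hn => hp ⟨n, ?_⟩
  · filter_upwards [eventually_ne_z p] with x hx
    refine (hΦ.hasDerivAt_wave hε hκ hx.1 hx.2).congr_deriv ?_
    rw [← hA1 x (hx.2 p), ← hB1 x (hx.2 p)]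
    have := sub_ne_zero.2 (hx.2 p)
    field_simp
    ring
  · rw [← hn, hA0]
    ring

/-- The value of an analytic extension at `z_p`. -/
theorem residue_eq_of_extension {ε lam μ : ℝ} {v : Fin P → ℂ} {Φ : ℂ → ℂ} (hε : 0 < ε)
    (hΦ : ∀ x ∈ u.G, HasDerivAt Φ (weight u ε lam x * ratFactor u μ v x) x)
    {F : ℂ → ℂ} {p : Fin P} (hF : AnalyticAt ℂ F (u.z p))
    (hFW : ∀ x ∈ u.G, 0 < x.im → F x = wave u ε lam Φ x) : v p = u.c p * F (u.z p) := by
  obtain ⟨A, hA, hA0, hA1⟩ := exists_regular_u₀ (u := u) lam p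
  obtain ⟨B, hB, hB0, hB1⟩ := exists_regular_ratFactor (u := u) μ v p
  have hε' : (ε : ℂ) ≠ 0 := by exact_mod_cast hε.ne'
  -- The limit is taken along a horizontal segment to the right of `z_p`, which lies in `G`, where
  -- `F` is known to equal `wave`.
  have := indicial_eq_zero (A := fun x => I / ε * A x) (B := fun x => -(I / ε) * B x) hF
    (continuousAt_const.mul hA.continuousAt) (continuousAt_const.mul hB.continuousAt)
    (l := map (fun t : ℝ => u.z p + t) (𝓝[>] 0)) (tendsto_add_ofReal_right _) ?_
  · rw [hA0, hB0] at this
    have h2 : I / ε * (u.c p * F (u.z p) - v p) = 0 := by linear_combination this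
    have h3 := (mul_eq_zero.1 h2).resolve_left (div_ne_zero I_ne_zero hε')
    exact (sub_eq_zero.1 h3).symm
  · rw [eventually_map]
    filter_upwards [(tendsto_add_ofReal_right (u.z p)).eventually
      ((u.isOpen_stripAt _).mem_nhds (u.self_mem_stripAt _)), self_mem_nhdsWithin] with t ht h0
    have h0' : (0 : ℝ) < t := h0
    set x := u.z p + t with hx
    have hG : x ∈ u.G := u.mem_G_of_mem_stripAt_z ht fun h => by simp [hx, h0'.ne'] at h
    have him : 0 < x.im := by simpa [hx] using u.im_z_pos p
    have hxz := u.ne_z_of_mem_G hG p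
    have hd : deriv F x = deriv (wave u ε lam Φ) x := by
      refine EventuallyEq.deriv_eq ?_
      filter_upwards [u.isOpen_G.mem_nhds hG,
        continuous_im.continuousAt.eventually_const_lt him] with y h1 h2 using hFW y h1 h2
    rw [hd, (hasDerivAt_wave_of_mem_G hG (hΦ x hG)).deriv, hFW x hG him, ← hA1 x hxz, ← hB1 x hxz]
    ring

end BenjaminOno

namespace BenjaminOno

open Complex Set Filter Topology

variable {P : ℕ} {u : RationalPotential P}

/-! ### The exceptional exponents -/

/-- Integration raises the order of vanishing by one once the value at `c` is zero; in terms of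
iterated derivatives this is a shift of index. -/
theorem exists_eq_pow_mul_of_deriv {χ s : ℂ → ℂ} {c : ℂ} {n : ℕ} (hχ : AnalyticAt ℂ χ c)
    (hs : AnalyticAt ℂ s c) (h0 : χ c = 0) (h : ∀ᶠ z in 𝓝 c, deriv χ z = (z - c) ^ n * s z) :
    ∃ g, AnalyticAt ℂ g c ∧ ∀ᶠ z in 𝓝 c, χ z = (z - c) ^ (n + 1) * g z := by
  have hd : (n : ℕ∞) ≤ analyticOrderAt (deriv χ) c :=
    (natCast_le_analyticOrderAt hχ.deriv).2 ⟨s, hs, h⟩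
  rw [natCast_le_analyticOrderAt_iff_iteratedDeriv_eq_zero hχ.deriv] at hd
  refine (natCast_le_analyticOrderAt hχ).1
    ((natCast_le_analyticOrderAt_iff_iteratedDeriv_eq_zero hχ).2 fun i hi => ?_)
  cases i with
  | zero => simpa using h0
  | succ k => rw [iteratedDeriv_succ']; exact hd k (by omega)

/-- The logarithm of `z_p` enters the exponent with coefficient `-i c_p/ε = n + 1`, so it
contributes `(i(x - z_p))^(n+1)`. The rest of `f` is analytic at `z_p`. -/
theorem exists_weight_eq_pow_mul {ε lam : ℝ} (hε : 0 < ε) {p : Fin P} {n : ℕ}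
    (hp : I * u.c p / ε = -((n : ℂ) + 1)) :
    ∃ g : ℂ → ℂ, AnalyticAt ℂ g (u.z p) ∧ g (u.z p) ≠ 0 ∧
      ∀ x ≠ u.z p, weight u ε lam x = (x - u.z p) ^ (n + 1) * g x := by
  set L : Fin P → ℂ → ℂ := Function.update (fun p x => Complex.log (I * (x - u.z p))) p 0 with hL
  have hk : AnalyticAt ℂ (u.fWith L) (u.z p) := by
    have hopen : IsOpen (u.stripAt (u.z p) ∩ {x | 0 < x.im}) :=
      (u.isOpen_stripAt _).inter (isOpen_lt continuous_const continuous_im)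
    refine DifferentiableOn.analyticAt (s := u.stripAt (u.z p) ∩ {x | 0 < x.im}) (fun x hx => ?_)
      (hopen.mem_nhds ⟨u.self_mem_stripAt _, u.im_z_pos p⟩)
    refine (u.hasDerivAt_fWith (d := fun j => if j = p then 0 else 1 / (x - u.z j)) (fun j => ?_)
      fun j => u.neg_mul_sub_conj_mem_slitPlane_of_im_pos hx.2 j).differentiableAt.differentiableWithinAt
    by_cases hj : j = p
    · subst hj
      rw [hL, Function.update_self, if_pos rfl]
      exact hasDerivAt_const x (0 : ℂ)
    · rw [hL, Function.update_of_ne hj, if_neg hj]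
      exact RationalPotential.hasDerivAt_log_mul_sub I_ne_zero
        (u.mul_sub_mem_slitPlane_of_mem_stripAt hx.1 hj)
  have hε' : (ε : ℂ) ≠ 0 := by exact_mod_cast hε.ne'
  refine ⟨fun x => I ^ (n + 1) * Complex.exp (-I * (lam * x + u.fWith L x) / ε), by fun_prop,
    mul_ne_zero (pow_ne_zero _ I_ne_zero) (Complex.exp_ne_zero _), fun x hx => ?_⟩
  have hf : u.f x = u.fWith L x + u.c p * Complex.log (I * (x - u.z p)) := by
    rw [hL, u.fWith_update_sub, ← u.f_eq_fWith]
    simp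
  have hx' : I * (x - u.z p) ≠ 0 := mul_ne_zero I_ne_zero (sub_ne_zero.2 hx)
  have he : -I * (lam * x + u.f x) / ε = -I * (lam * x + u.fWith L x) / ε +
      ((n + 1 : ℕ) : ℂ) * Complex.log (I * (x - u.z p)) := by
    rw [hf]
    push_cast
    linear_combination -Complex.log (I * (x - u.z p)) * hp
  rw [weight, he, Complex.exp_add, Complex.exp_nat_mul, Complex.exp_log hx', mul_pow]
  ring

theorem monodromy_eq_one {ε : ℝ} {p : Fin P} {n : ℕ} (hp : I * u.c p / ε = -((n : ℂ) + 1)) :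
    monodromy u ε p = 1 := by
  have : -I * (2 * Real.pi * I * u.c p) / ε = ((n + 1 : ℕ) : ℂ) * (2 * Real.pi * I) := by
    push_cast
    linear_combination -(2 * Real.pi * I) * hp
  rw [monodromy, this, Complex.exp_nat_mul_two_pi_mul_I]

theorem exists_weight_mul_ratFactor_eq {ε lam μ : ℝ} {v : Fin P → ℂ} (hε : 0 < ε) {p : Fin P}
    {n : ℕ} (hp : I * u.c p / ε = -((n : ℂ) + 1)) :
    ∃ s : ℂ → ℂ, AnalyticAt ℂ s (u.z p) ∧
      ∀ x ≠ u.z p, weight u ε lam x * ratFactor u μ v x = (x - u.z p) ^ n * s x := by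
  obtain ⟨g, hg, -, hg1⟩ := exists_weight_eq_pow_mul (lam := lam) hε hp
  obtain ⟨B, hB, -, hB1⟩ := exists_regular_ratFactor (u := u) μ v p
  refine ⟨fun x => g x * B x, hg.mul hB, fun x hx => ?_⟩
  simp only
  rw [hg1 x hx, ← hB1 x hx]
  ring

theorem nhdsWithin_G_le (p : Fin P) : 𝓝[u.G] (u.z p) ≤ 𝓝[≠] (u.z p) :=
  nhdsWithin_mono _ fun _ hx => u.ne_z_of_mem_G hx p

theorem exists_bound_at_exceptional {ε lam μ : ℝ} {v : Fin P → ℂ} (hε : 0 < ε) {p : Fin P}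
    {n : ℕ} (hp : I * u.c p / ε = -((n : ℂ) + 1)) :
    ∃ M, ∀ᶠ y in 𝓝[u.G] (u.z p), ‖weight u ε lam y * ratFactor u μ v y‖ ≤ M := by
  obtain ⟨s, hs, hs1⟩ := exists_weight_mul_ratFactor_eq (lam := lam) (μ := μ) (v := v) hε hp
  have hc : ContinuousAt (fun x => ‖(x - u.z p) ^ n * s x‖) (u.z p) :=
    (ContinuousAt.mul (by fun_prop) hs.continuousAt).norm
  refine ⟨‖(u.z p - u.z p) ^ n * s (u.z p)‖ + 1, ?_⟩
  filter_upwards [(hc.eventually_lt continuousAt_const (lt_add_one _)).filter_mono nhdsWithin_le_nhds,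
    self_mem_nhdsWithin] with x hx hG
  rw [hs1 x (u.ne_z_of_mem_G hG p)]
  exact hx.le

/-- At an exceptional pole there is no jump, and a primitive extends analytically. -/
theorem HasJumps.exists_analytic_primitive {ε lam μ : ℝ} {v : Fin P → ℂ} {Φ : ℂ → ℂ}
    {κ : Fin P → ℂ} (hε : 0 < ε)
    (hΦ : HasJumps u Φ (fun x => weight u ε lam x * ratFactor u μ v x) (monodromy u ε) κ)
    {p : Fin P} {n : ℕ} (hp : I * u.c p / ε = -((n : ℂ) + 1)) :
    κ p = 0 ∧ ∃ Ψ s : ℂ → ℂ, AnalyticAt ℂ Ψ (u.z p) ∧ AnalyticAt ℂ s (u.z p) ∧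
      (∀ᶠ x in 𝓝 (u.z p), deriv Ψ x = (x - u.z p) ^ n * s x) ∧
      ∀ᶠ x in 𝓝[≠] (u.z p), Φ x = Ψ x := by
  obtain ⟨s, hs, hs1⟩ := exists_weight_mul_ratFactor_eq (lam := lam) (μ := μ) (v := v) hε hp
  obtain ⟨ρ, hρ, hball⟩ := Metric.nhds_basis_ball.eventually_iff.1
    (hs.eventually_analyticAt.and (((u.isOpen_stripAt (u.z p)).eventually_mem
      (u.self_mem_stripAt (u.z p))).and
      (continuous_im.continuousAt.eventually_const_lt (u.im_z_pos p))))
  set B := Metric.ball (u.z p) ρ with hB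
  have hBc : Convex ℝ B := convex_ball _ _
  have hBo : IsOpen B := Metric.isOpen_ball
  obtain ⟨Ψ, hΨ⟩ := exists_primitive_of_convex hBc hBo (g := fun x => (x - u.z p) ^ n * s x)
    fun x hx => (DifferentiableAt.mul (by fun_prop)
      (hball hx).1.differentiableAt).differentiableWithinAt
  -- The punctured ball is covered by its right, left, lower and upper halves. On the first three
  -- `Φ` is compared with `Ψ`; on the upper half, which contains the cut, its continuation `R` is.
  have hcmp : ∀ S : Set ℂ, Convex ℝ S → IsOpen S → B ∩ S ⊆ u.G →
      ∃ a, ∀ x ∈ B ∩ S, Φ x = Ψ x + a := fun S hS hSo hSG =>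
    exists_eq_add_const (hBc.inter hS) (hBo.inter hSo)
      (fun x hx => by
        rw [← hs1 x (u.ne_z_of_mem_G (hSG hx) p)]
        exact hΦ.hasDerivAt x (hSG hx)) fun x hx => hΨ x hx.1
  obtain ⟨a₁, h1⟩ := hcmp _ (convex_halfSpace_re_gt (u.z p).re)
    (isOpen_lt continuous_const continuous_re) fun x hx =>
      u.mem_G_of_mem_stripAt_z (hball hx.1).2.1 fun h => absurd h (ne_of_gt hx.2)
  obtain ⟨a₂, h2⟩ := hcmp _ (convex_halfSpace_re_lt (u.z p).re)
    (isOpen_lt continuous_re continuous_const) fun x hx =>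
      u.mem_G_of_mem_stripAt_z (hball hx.1).2.1 fun h => absurd h (ne_of_lt hx.2)
  obtain ⟨a₃, h3⟩ := hcmp _ (convex_halfSpace_im_lt (u.z p).im)
    (isOpen_lt continuous_im continuous_const) fun x hx =>
      u.mem_G_of_mem_stripAt_z (hball hx.1).2.1 fun h => by
        rw [abs_of_pos (hball hx.1).2.2]; exact hx.2
  obtain ⟨R, R', hR⟩ := hΦ.jump p
  have hsub : ∀ x ∈ B ∩ {x | (u.z p).im < x.im}, x ∈ u.aboveStrip p :=
    fun x hx => ⟨(hball hx.1).2.1, hx.2⟩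
  have hR' : ∀ x ∈ B ∩ {x | (u.z p).im < x.im}, HasDerivAt R ((x - u.z p) ^ n * s x) x := by
    intro x hx
    have hxs := hsub x hx
    rw [← hs1 x (u.ne_z_of_mem_aboveStrip hxs p)]
    rcases le_or_gt (u.z p).re x.re with h | h
    · rw [← ((hR x hxs).2.1 h).2]
      exact (hR x hxs).1
    · refine ((hΦ.hasDerivAt x (u.mem_G_of_mem_aboveStrip hxs h.ne)).add_const
        (κ p)).congr_of_eventuallyEq ?_
      filter_upwards [(u.isOpen_aboveStrip p).mem_nhds hxs,
        continuous_re.continuousAt.eventually_lt_const h] with y hy hre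
      rw [(hR y hy).2.2 hre, monodromy_eq_one hp, one_mul]
  obtain ⟨a₄, h4⟩ := exists_eq_add_const (hBc.inter (convex_halfSpace_im_gt (u.z p).im))
    (hBo.inter (isOpen_lt continuous_const continuous_im)) hR' fun x hx => hΨ x hx.1
  -- One point in each quadrant, where two adjacent halves overlap, to compare the constants.
  have hpt : ∀ a b : ℝ, |a| = ρ / 3 → |b| = ρ / 3 → u.z p + (a + b * I) ∈ B := by
    intro a b ha hb
    rw [hB, mem_ball_iff_norm, add_sub_cancel_left]
    calc ‖(a + b * I : ℂ)‖ ≤ ‖(a : ℂ)‖ + ‖(b * I : ℂ)‖ := norm_add_le _ _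
      _ = ρ / 3 + ρ / 3 := by simp [ha, hb]
      _ < ρ := by linarith
  have habs : |ρ / 3| = ρ / 3 := abs_of_pos (by positivity)
  have habs' : |-(ρ / 3)| = ρ / 3 := by rw [abs_neg, habs]
  have hρ3 : 0 < ρ / 3 := by positivity
  have e13 : a₁ = a₃ := by
    have hm := hpt (ρ / 3) (-(ρ / 3)) habs habs'
    have k1 := h1 _ ⟨hm, by simpa using hρ⟩
    have k3 := h3 _ ⟨hm, by simpa using hρ⟩
    exact add_left_cancel (k1.symm.trans k3)
  have e23 : a₂ = a₃ := by
    have hm := hpt (-(ρ / 3)) (-(ρ / 3)) habs' habs'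
    have k2 := h2 _ ⟨hm, by simpa using hρ⟩
    have k3 := h3 _ ⟨hm, by simpa using hρ⟩
    exact add_left_cancel (k2.symm.trans k3)
  have e14 : a₁ = a₄ := by
    have hm := hpt (ρ / 3) (ρ / 3) habs habs
    have hu : u.z p + (((ρ / 3 : ℝ) : ℂ) + ((ρ / 3 : ℝ) : ℂ) * I) ∈
        {x : ℂ | (u.z p).im < x.im} := by simpa using hρ
    have k1 := h1 _ ⟨hm, by simpa using hρ⟩
    have k4 := h4 _ ⟨hm, hu⟩
    rw [((hR _ (hsub _ ⟨hm, hu⟩)).2.1 (by simpa using hρ3.le)).1] at k4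
    exact add_left_cancel (k1.symm.trans k4)
  -- The upper left quadrant closes the circuit: there the continuation is `Φ + κ`, and all four
  -- constants already agree.
  have hκ : κ p = 0 := by
    have hm := hpt (-(ρ / 3)) (ρ / 3) habs' habs
    have hu : u.z p + (((-(ρ / 3) : ℝ) : ℂ) + ((ρ / 3 : ℝ) : ℂ) * I) ∈
        {x : ℂ | (u.z p).im < x.im} := by simpa using hρ
    have k2 := h2 _ ⟨hm, by simpa using hρ⟩
    have k4 := h4 _ ⟨hm, hu⟩
    rw [(hR _ (hsub _ ⟨hm, hu⟩)).2.2 (by simpa using hρ), monodromy_eq_one hp, one_mul, k2] at k4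
    linear_combination k4 - e14 + e13 - e23
  have hBn : B ∈ 𝓝 (u.z p) := Metric.ball_mem_nhds _ hρ
  have hd : DifferentiableOn ℂ (fun x => Ψ x + a₃) B := fun x hx =>
    ((hΨ x hx).add_const a₃).differentiableAt.differentiableWithinAt
  refine ⟨hκ, fun x => Ψ x + a₃, s, hd.analyticAt hBn, hs, ?_, ?_⟩
  · filter_upwards [hBn] with x hx using ((hΨ x hx).add_const a₃).deriv
  · filter_upwards [mem_nhdsWithin_of_mem_nhds hBn, self_mem_nhdsWithin] with x hx hxz
    rcases lt_trichotomy x.re (u.z p).re with h | h | h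
    · rw [h2 x ⟨hx, h⟩, e23]
    · rcases lt_trichotomy x.im (u.z p).im with h' | h' | h'
      · exact h3 x ⟨hx, h'⟩
      · exact absurd (Complex.ext h h') hxz
      · rw [← ((hR x (hsub x ⟨hx, h'⟩)).2.1 h.ge).1, h4 x ⟨hx, h'⟩, ← e14, e13]
    · rw [h1 x ⟨hx, h⟩, e13]

/-- At an exceptional pole `wave` extends analytically if the primitive vanishes there. -/
theorem exists_analyticAt_wave_of_exceptional {ε lam : ℝ} {Φ : ℂ → ℂ} (hε : 0 < ε) {p : Fin P}
    {n : ℕ} (hp : I * u.c p / ε = -((n : ℂ) + 1)) {Ψ s : ℂ → ℂ} (hΨ : AnalyticAt ℂ Ψ (u.z p))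
    (hs : AnalyticAt ℂ s (u.z p))
    (hd : ∀ᶠ x in 𝓝 (u.z p), deriv Ψ x = (x - u.z p) ^ n * s x)
    (hΦ : ∀ᶠ x in 𝓝[≠] (u.z p), Φ x = Ψ x) (h0 : Ψ (u.z p) = 0) :
    ∃ ω : ℂ → ℂ, AnalyticAt ℂ ω (u.z p) ∧ ∀ᶠ x in 𝓝[≠] (u.z p), wave u ε lam Φ x = ω x := by
  obtain ⟨g, hg, hg0, hg1⟩ := exists_weight_eq_pow_mul (lam := lam) hε hp
  obtain ⟨k, hk, hk1⟩ := exists_eq_pow_mul_of_deriv hΨ hs h0 hd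
  -- The primitive and the weight both carry the factor `(x - z_p)^(n+1)`, which cancels in the
  -- quotient.
  refine ⟨fun x => -(I / ε) * (k x / g x), analyticAt_const.mul (hk.div hg hg0), ?_⟩
  filter_upwards [hΦ, hk1.filter_mono nhdsWithin_le_nhds,
    (hg.continuousAt.eventually_ne hg0).filter_mono nhdsWithin_le_nhds,
    self_mem_nhdsWithin] with x h1 h2 h3 hx
  have hx' : x - u.z p ≠ 0 := sub_ne_zero.2 hx
  have hw : Complex.exp (I * (lam * x + u.f x) / ε) = ((x - u.z p) ^ (n + 1) * g x)⁻¹ := by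
    rw [← hg1 x hx, weight, ← Complex.exp_neg]
    congr 1
    ring
  rw [wave, h1, h2, hw]
  field_simp

/-- If `wave` stays bounded at an exceptional pole, then the primitive vanishes there. -/
theorem tendsto_primitive_zero_of_extension {ε lam : ℝ} {Φ F : ℂ → ℂ} (hε : 0 < ε) {p : Fin P}
    {n : ℕ} (hp : I * u.c p / ε = -((n : ℂ) + 1)) (hF : ContinuousAt F (u.z p))
    (hFW : ∀ x ∈ u.G, 0 < x.im → F x = wave u ε lam Φ x) :
    Tendsto Φ (𝓝[u.G] (u.z p)) (𝓝 0) := by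
  obtain ⟨g, hg, -, hg1⟩ := exists_weight_eq_pow_mul (lam := lam) hε hp
  have hε' : (ε : ℂ) ≠ 0 := by exact_mod_cast hε.ne'
  -- This is `Φ` recovered from `wave` as `iε` times `wave` times the weight, and the weight
  -- vanishes at `z_p`.
  have hc : ContinuousAt (fun x => (ε * I) * F x * ((x - u.z p) ^ (n + 1) * g x)) (u.z p) := by
    have := hg.continuousAt
    fun_prop
  have h1 : Tendsto (fun x => (ε * I) * F x * ((x - u.z p) ^ (n + 1) * g x)) (𝓝[u.G] (u.z p))
      (𝓝 0) := by
    have := hc.tendsto.mono_left (nhdsWithin_le_nhds (s := u.G))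
    simpa using this
  refine h1.congr' ?_
  filter_upwards [(continuous_im.continuousAt.eventually_const_lt (u.im_z_pos p)).filter_mono
    nhdsWithin_le_nhds, self_mem_nhdsWithin] with x him hG
  rw [← hg1 x (u.ne_z_of_mem_G hG p), hFW x hG him, wave, weight]
  have h2 : Complex.exp (I * (lam * x + u.f x) / ε) * Complex.exp (-I * (lam * x + u.f x) / ε) = 1 := by
    rw [← Complex.exp_add, ← Complex.exp_zero]
    congr 1
    ring
  have h3 : (ε * I) * -(I / ε) = (1 : ℂ) := by
    field_simp
    rw [I_sq, neg_neg]
  linear_combination ((ε * I) * -(I / ε) * Φ x) * h2 + Φ x * h3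

end BenjaminOno

namespace BenjaminOno

open Complex Set Filter Topology

variable {P : ℕ} {u : RationalPotential P}

/-! ### Contours `C_m` -/

theorem IsContourC.integrable {ε lam μ : ℝ} {v : Fin P → ℂ} (hε : 0 < ε) (hlam : 0 < lam)
    {m : Fin P} {C : LiftedContour} (hC : IsContourC u ε m C) :
    MeasureTheory.Integrable (pullback ε lam C (ratFactor u μ v)) := by
  by_cases h : ∃ n : ℕ, I * u.c m / ε = -((n : ℂ) + 1)
  · obtain ⟨n, hn⟩ := h
    exact (hC.1 ⟨n, hn⟩).integrable hε hlam (exists_bound_at_exceptional hε hn)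
  · exact (hC.2 h).integrable hε hlam

/-- The contour integrals vanish if and only if the primitive has no jumps and vanishes at the
exceptional poles. -/
theorem forall_contourIntegral_eq_zero_iff {ε lam μ : ℝ} {v : Fin P → ℂ} (hε : 0 < ε)
    (hlam : 0 < lam) {C : Fin P → LiftedContour} (hC : ∀ m, IsContourC u ε m (C m))
    {Φ : ℂ → ℂ} {κ : Fin P → ℂ}
    (hΦ : HasJumps u Φ (fun x => weight u ε lam x * ratFactor u μ v x) (monodromy u ε) κ)
    (h0 : ∀ γ : ℝ → ℂ, (∃ K, LipschitzWith K γ) → StartsAtNegI u γ →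
      Tendsto (fun t => Φ (γ t)) atBot (𝓝 0)) :
    (∀ m, contourIntegral ε lam (C m) (ratFactor u μ v) = 0) ↔
      (∀ p, κ p = 0) ∧ ∀ p, (∃ n : ℕ, I * u.c p / ε = -((n : ℂ) + 1)) →
        Tendsto Φ (𝓝[u.G] (u.z p)) (𝓝 0) := by
  constructor
  · intro h
    refine ⟨fun p => ?_, fun p hp => ?_⟩
    -- Triangular elimination: with `κ_j = 0` for `j < m`, the loop integral is a product of
    -- monodromies times `κ_m`. At an exceptional `m` the jump is zero for free.
    · induction p using WellFoundedLT.induction with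
      | _ m ih =>
      by_cases hm : ∃ n : ℕ, I * u.c m / ε = -((n : ℂ) + 1)
      · obtain ⟨n, hn⟩ := hm
        exact (hΦ.exists_analytic_primitive hε hn).1
      · obtain ⟨τ, hτ⟩ := ((hC m).2 hm).exists_crosses
        have h1 := ((hC m).2 hm).contourIntegral_eq hε hlam hτ hΦ h0
        rw [h m, Finset.sum_eq_single_of_mem m (Finset.mem_Iic.2 le_rfl) fun j hj hjm => by
          rw [ih j (lt_of_le_of_ne (Finset.mem_Iic.1 hj) hjm), mul_zero]] at h1
        exact (mul_eq_zero.1 h1.symm).resolve_left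
          (Finset.prod_ne_zero_iff.2 fun j _ => monodromy_ne_zero u ε j)
    · obtain ⟨n, hn⟩ := hp
      obtain ⟨-, Ψ, s, hΨ, -, -, hΦΨ⟩ := hΦ.exists_analytic_primitive hε hn
      have hlim : Tendsto Φ (𝓝[u.G] (u.z p)) (𝓝 (Ψ (u.z p))) :=
        (hΨ.continuousAt.tendsto.mono_left nhdsWithin_le_nhds).congr'
          ((hΦΨ.filter_mono (nhdsWithin_G_le p)).mono fun x hx => hx.symm)
      have := ((hC p).1 ⟨n, hn⟩).contourIntegral_eq ((hC p).integrable hε hlam) hΦ.hasDerivAt h0 hlim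
      rwa [← this, h p] at hlim
  · rintro ⟨hκ, hz⟩ m
    by_cases hm : ∃ n : ℕ, I * u.c m / ε = -((n : ℂ) + 1)
    · exact ((hC m).1 hm).contourIntegral_eq ((hC m).integrable hε hlam) hΦ.hasDerivAt h0 (hz m hm)
    · obtain ⟨τ, hτ⟩ := ((hC m).2 hm).exists_crosses
      rw [((hC m).2 hm).contourIntegral_eq hε hlam hτ hΦ h0]
      exact Finset.sum_eq_zero fun p _ => by rw [hκ p, mul_zero]

/-! ### Analytic extension to the upper half-plane -/

theorem nhdsWithin_G_neBot (p : Fin P) : (𝓝[u.G] (u.z p)).NeBot := by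
  have h : Tendsto (fun t : ℝ => u.z p + t) (𝓝[>] 0) (𝓝[u.G] (u.z p)) := by
    refine tendsto_nhdsWithin_iff.2 ⟨tendsto_add_ofReal_right _, ?_⟩
    filter_upwards [(tendsto_add_ofReal_right (u.z p)).eventually
      ((u.isOpen_stripAt _).eventually_mem (u.self_mem_stripAt _)), self_mem_nhdsWithin] with t ht h0
    have h0' : (0 : ℝ) < t := h0
    exact u.mem_G_of_mem_stripAt_z ht fun h => by simp [h0'.ne'] at h
  exact h.neBot

/-- Analytic extendability of `wave` to the upper half-plane. -/
theorem exists_extension_wave_iff {ε lam μ : ℝ} {v : Fin P → ℂ} (hε : 0 < ε)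
    {Φ : ℂ → ℂ} {κ : Fin P → ℂ}
    (hΦ : HasJumps u Φ (fun x => weight u ε lam x * ratFactor u μ v x) (monodromy u ε) κ) :
    (∃ F, IsAnalyticExtension u (wave u ε lam Φ) F) ↔
      (∀ p, κ p = 0) ∧ ∀ p, (∃ n : ℕ, I * u.c p / ε = -((n : ℂ) + 1)) →
        Tendsto Φ (𝓝[u.G] (u.z p)) (𝓝 0) := by
  constructor
  · rintro ⟨F, hF, hFW⟩
    exact ⟨hΦ.eq_zero_of_extension hε (fun x hx => (hF x hx).continuousAt) hFW,
      fun p ⟨n, hn⟩ => tendsto_primitive_zero_of_extension hε hn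
        (hF _ (u.im_z_pos p)).continuousAt hFW⟩
  · rintro ⟨hκ, hz⟩
    have key : ∀ p, ∃ ω : ℂ → ℂ, AnalyticAt ℂ ω (u.z p) ∧
        ∀ᶠ x in 𝓝[≠] (u.z p), wave u ε lam Φ x = ω x := by
      intro p
      by_cases hp : ∃ n : ℕ, I * u.c p / ε = -((n : ℂ) + 1)
      · obtain ⟨n, hn⟩ := hp
        obtain ⟨-, Ψ, s, hΨ, hs, hd, hΦΨ⟩ := hΦ.exists_analytic_primitive hε hn
        have hlim : Tendsto Φ (𝓝[u.G] (u.z p)) (𝓝 (Ψ (u.z p))) :=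
          (hΨ.continuousAt.tendsto.mono_left nhdsWithin_le_nhds).congr'
            ((hΦΨ.filter_mono (nhdsWithin_G_le p)).mono fun x hx => hx.symm)
        have := nhdsWithin_G_neBot (u := u) p
        exact exists_analyticAt_wave_of_exceptional hε hn hΨ hs hd hΦΨ
          (tendsto_nhds_unique hlim (hz p ⟨n, hn⟩))
      · exact hΦ.exists_analyticAt_wave hε hκ hp
    choose ω hω hωW using key
    classical
    have hoff : ∀ x, (∀ p, x ≠ u.z p) → ∀ᶠ y in 𝓝 x, ∀ p, y ≠ u.z p := fun x hx =>
      eventually_all.2 fun p => isOpen_compl_singleton.mem_nhds (hx p)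
    -- Only the values at the poles need correction: on the upper cuts `wave` already has its limits
    -- from the right.
    set F : ℂ → ℂ := fun x => if h : ∃ p, x = u.z p then ω h.choose x else wave u ε lam Φ x with hF
    have hFne : ∀ x, (∀ p, x ≠ u.z p) → F x = wave u ε lam Φ x := fun x hx =>
      dif_neg (by simpa using hx)
    refine ⟨F, fun x hx => ?_, fun x hx _ => hFne x (u.ne_z_of_mem_G hx)⟩
    by_cases h : ∃ p, x = u.z p
    · obtain ⟨p, rfl⟩ := h
      refine (hω p).congr ?_
      have h1 : ∀ᶠ x in 𝓝[≠] (u.z p), ω p x = F x := by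
        filter_upwards [hωW p, eventually_ne_z p] with x h1 h2
        rw [hFne x h2.2, h1]
      refine (eventually_nhdsWithin_iff.1 h1).mono fun x h2 => ?_
      by_cases hxp : x = u.z p
      · subst hxp
        have hex : ∃ j, u.z p = u.z j := ⟨p, rfl⟩
        simp only [hF, dif_pos hex]
        rw [← u.re_z_strictMono.injective (congrArg re hex.choose_spec)]
      · exact h2 hxp
    · push Not at h
      have hw : AnalyticAt ℂ (wave u ε lam Φ) x := by
        refine (analyticAt_iff_eventually_differentiableAt).2 ?_
        filter_upwards [hoff x h, continuous_im.continuousAt.eventually_const_lt hx] with y h1 h2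
        exact (hΦ.hasDerivAt_wave hε hκ h2 h1).differentiableAt
      exact hw.congr ((hoff x h).mono fun y hy => (hFne y hy).symm)

/-! ### Linearity and the linear system -/

theorem ratFactor_one : ratFactor u (1 : ℝ) 0 = fun _ => 1 := by
  ext x; simp [ratFactor]

/-- The entries of `A^>` and `b^>` are integrals of special rational factors. This is why the
convergence lemmas carry a constant `μ` independent of `lam`. -/
theorem ratFactor_single (p : Fin P) :
    ratFactor u (0 : ℝ) (Pi.single p 1) = fun x => 1 / (x - u.z p) := by
  ext x
  rw [ratFactor, Finset.sum_eq_single p]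
  · simp
  · intro j _ hj
    simp [Pi.single_eq_of_ne hj]
  · simp

theorem contourIntegral_ratFactor {ε lam : ℝ} (v : Fin P → ℂ) {C : LiftedContour}
    (h1 : MeasureTheory.Integrable (pullback ε lam C fun _ => 1))
    (hp : ∀ p, MeasureTheory.Integrable (pullback ε lam C fun x => 1 / (x - u.z p))) :
    contourIntegral ε lam C (ratFactor u lam v) =
      ∑ p, contourIntegral ε lam C (fun x => 1 / (x - u.z p)) * v p +
        lam * contourIntegral ε lam C fun _ => 1 := by
  have : pullback ε lam C (ratFactor u lam v) = fun t =>
      ∑ p, pullback ε lam C (fun x => 1 / (x - u.z p)) t * v p +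
        lam * pullback ε lam C (fun _ => 1) t := by
    ext t
    simp only [pullback, ratFactor, mul_add, add_mul, Finset.mul_sum, Finset.sum_mul]
    congr 1
    · exact Finset.sum_congr rfl fun p _ => by ring
    · ring
  rw [contourIntegral, this, MeasureTheory.integral_add
    (MeasureTheory.integrable_finsetSum _ fun p _ => (hp p).mul_const _) (h1.const_mul _),
    MeasureTheory.integral_finsetSum _ fun p _ => (hp p).mul_const _,
    MeasureTheory.integral_const_mul]
  simp only [MeasureTheory.integral_mul_const]
  rfl

end BenjaminOno

theorem corollary3p2 {P : ℕ} (u : BenjaminOno.RationalPotential P) (ε lam : ℝ)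
    (hε : 0 < ε) (hlam : 0 < lam) (v : Fin P → ℂ)
    (ell : ℂ → BenjaminOno.LiftedContour)
    (hell : ∀ x ∈ u.G, BenjaminOno.IsEllZero u x (ell x))
    (C : Fin P → BenjaminOno.LiftedContour)
    (hC : ∀ m, BenjaminOno.IsContourC u ε m (C m)) :
    -- all the integrals converge absolutely
    (∀ x ∈ u.G, MeasureTheory.Integrable
      (BenjaminOno.pullback ε lam (ell x) (BenjaminOno.ratFactor u lam v))) ∧
    (∀ m, MeasureTheory.Integrable
        (BenjaminOno.pullback ε lam (C m) (BenjaminOno.ratFactor u lam v)) ∧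
      MeasureTheory.Integrable (BenjaminOno.pullback ε lam (C m) fun _ => 1) ∧
      ∀ p, MeasureTheory.Integrable
        (BenjaminOno.pullback ε lam (C m) fun x => 1 / (x - u.z p))) ∧
    -- analyticity in the upper half-plane is equivalent to the vanishing of the contour integrals
    ((∃ F, BenjaminOno.IsAnalyticExtension u (BenjaminOno.Wplus u ε lam v ell) F) ↔
      ∀ m, BenjaminOno.contourIntegral ε lam (C m) (BenjaminOno.ratFactor u lam v) = 0) ∧
    -- and to the linear system
    ((∃ F, BenjaminOno.IsAnalyticExtension u (BenjaminOno.Wplus u ε lam v ell) F) ↔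
      (BenjaminOno.matrixA u ε lam C).mulVec v = BenjaminOno.vectorB ε lam C) ∧
    -- in which case the parameters are `v_p = c_p W_+(z_p)`
    (∀ F, BenjaminOno.IsAnalyticExtension u (BenjaminOno.Wplus u ε lam v ell) F →
      ∀ p, v p = u.c p * F (u.z p)) := by
  open BenjaminOno in
  have hell_int : ∀ x ∈ u.G, MeasureTheory.Integrable (pullback ε lam (ell x) (ratFactor u lam v)) :=
    fun x hx => (hell x hx).integrable_of_mem hε hlam hx
  have hone : ∀ m, MeasureTheory.Integrable (pullback ε lam (C m) fun _ => 1) := fun m => by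
    have := (hC m).integrable (μ := 1) (v := 0) hε hlam
    rwa [ratFactor_one] at this
  have hsingle : ∀ m p, MeasureTheory.Integrable
      (pullback ε lam (C m) fun x => 1 / (x - u.z p)) := fun m p => by
    have := (hC m).integrable (μ := 0) (v := Pi.single p 1) hε hlam
    rwa [ratFactor_single] at this
  -- A real point to the left of all poles lies in `G`; the given contour to it provides the
  -- normalisation of `Φ` at `-i∞`.
  obtain ⟨b, hb⟩ := u.exists_lt_re
  have hbG : (b : ℂ) ∈ u.G := u.mem_G_of_mem_G₀ fun p => by simpa using hb p
  obtain ⟨Φ, κ, hΦ, h0⟩ := exists_normalized_primitive (μ := lam) (v := v) hε hlam (hell b hbG) hbG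
  have hW : ∀ x ∈ u.G, Wplus u ε lam v ell x = wave u ε lam Φ x := fun x hx => by
    rw [Wplus, wave, (hell x hx).contourIntegral_eq (hell_int x hx) hΦ.hasDerivAt h0
      ((hΦ.hasDerivAt x hx).continuousAt.tendsto.mono_left nhdsWithin_le_nhds)]
  have hext : ∀ F, IsAnalyticExtension u (Wplus u ε lam v ell) F ↔
      IsAnalyticExtension u (wave u ε lam Φ) F := fun F =>
    and_congr_right fun _ => forall₂_congr fun x hx => by rw [hW x hx]
  have hiff : (∃ F, IsAnalyticExtension u (Wplus u ε lam v ell) F) ↔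
      ∀ m, contourIntegral ε lam (C m) (ratFactor u lam v) = 0 := by
    simp only [hext]
    rw [exists_extension_wave_iff hε hΦ, forall_contourIntegral_eq_zero_iff hε hlam hC hΦ h0]
  refine ⟨hell_int, fun m => ⟨(hC m).integrable hε hlam, hone m, hsingle m⟩, hiff, ?_, ?_⟩
  · rw [hiff, funext_iff]
    refine forall_congr' fun m => ?_
    rw [contourIntegral_ratFactor v (hone m) (hsingle m)]
    simp only [matrixA, vectorB, Matrix.mulVec, dotProduct, Matrix.of_apply]
    rw [neg_mul, eq_neg_iff_add_eq_zero]
  · intro F hF p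
    obtain ⟨hFa, hFW⟩ := (hext F).1 hF
    exact residue_eq_of_extension hε hΦ.hasDerivAt (hFa _ (u.im_z_pos p)) hFW
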